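/- Let $G$ be a second countable locally compact group, let $A$ and $B$ be (not necessarily unital) $C^*$-algebras with $A$ separable, both equipped with actions of $G$ by $*$-automorphisms such that $g\mapsto ga$ and $g\mapsto gb$ are norm continuous for all $a\in A$, $b\in B$, and let $I\subseteq B$ be a closed two-sided $G$-invariant ideal. Let $\pi:B\to B/I$ be the quotient map, and give $B/I$ the induced action of $G$. Conventions. A path $\psi=(\psi_t)_{t\in[1,\infty)}$ of (not necessarily linear) maps $\psi_t:A\to B$ is called *asymptotically cp* if - for each $a\in A$ the map $t\mapsto\psi_t(a)$ is continuous and bounded on $[1,\infty)$; - each $\psi_t$ is selfadjoint, i.e. $\psi_t(a^*)=\psi_t(a)^*$ for all $a\in A$; - $\lim_{t\to\infty}\|\psi_t(\mu a+\nu b)-\mu\psi_t(a)-\nu\psi_t(b)\|=0$ for all $a,b\in A$ and $\mu,\nu\in\mathbb C$; - for every $n$ and every positive $M\in M_n(A)$, the negative part of the entrywise image satisfies $\lim_{t\to\infty}\|(\psi_t^{(n)}(M))_-\|=0$. The path is *contractive* if $\|\psi_t(a)\|\le\|a\|$ for all $t,a$; it is *positive* if $\psi_t(a)\ge0$ whenever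 $a\ge0$, for all $t$; it is a *lift* of $\phi:A\to B/I$ if $\pi\circ\psi_t=\phi$ for all $t$. It is *asymptotically equivariant* if $\lim_{t\to\infty}\sup_{g\in K}\|g\psi_t(a)-\psi_t(ga)\|=0$ for every $a\in A$ and every compact $K\subseteq G$. It is *asymptotically order zero* if $\lim_{t\to\infty}\|\psi_t(a)\psi_t(b)\|=0$ for all positive $a,b\in A$ with $ab=0$. A completely positive map $\phi$ is *order zero* if $\phi(a)\phi(b)=0$ for all positive $a,b\in A$ with $ab=0$. **Proposition.** Let $\phi:A\to B/I$ be a contractive completely positive linear map, and suppose that $\phi$ has an asymptotically cp lift $(\psi_t)_{t\in[1,\infty)}$. Then $\phi$ has an asymptotically cp lift $(\bar\psi_t)_{t\in[1,\infty)}$, which is contractive if $(\psi_t)$ is contractive and positive if $(\psi_t)$ is positive, such that: 1. $\lim_{t\to\infty}\|\bar\psi_t(a)\bar\psi_t(b)\|=\|\phi(a)\phi(b)\|$ for all $a,b\in A$; 2. for every $a\in A$ and every compact $K\subseteq G$, $\|g\bar\psi_t(a)-\bar\psi_t(ha)\|\to\|g\phi(a)-\phi(ha)\|$ as $t\to\infty$,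 uniformly in $(g,h)\in K\times K$; in particular $$\lim_{t\to\infty}\ \sup_{g,h\in K}\|g\bar\psi_t(a)-\bar\psi_t(ha)\|=\sup_{g,h\in K}\|g\phi(a)-\phi(ha)\|;$$ 3. if $\phi$ is equivariant, then $(\bar\psi_t)$ is asymptotically equivariant; 4. if $\phi$ is order zero, then $(\bar\psi_t)$ is asymptotically order zero. -/

import Mathlib

open Filter Topology
open scoped CStarAlgebra

/-- The negative part `x₋` of a selfadjoint element `x` of a C⋆-algebra (continuous functional
calculus with `r ↦ max (-r) 0`). -/
noncomputable def cstarNegPart {E : Type*} [NonUnitalCStarAlgebra E] (x : E) : E := x⁻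

section Paths

variable {A B Q : Type*} [NonUnitalCStarAlgebra A] [NonUnitalCStarAlgebra B]
  [NonUnitalCStarAlgebra Q]

/-- Each map of the path `ψ` is norm-nonincreasing (`ψ t` need not be linear). -/
def IsContractivePath (ψ : Set.Ici (1 : ℝ) → A → B) : Prop :=
  ∀ t a, ‖ψ t a‖ ≤ ‖a‖

/-- Each map `ψ t` is a lift of `φ` through `π`. -/
def IsLiftPath (π : B →⋆ₙₐ[ℂ] Q) (φ : A → Q) (ψ : Set.Ici (1 : ℝ) → A → B) : Prop :=
  ∀ t a, π (ψ t a) = φ a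

variable [PartialOrder A] [StarOrderedRing A] [PartialOrder B] [StarOrderedRing B]
  [PartialOrder Q] [StarOrderedRing Q]

/-- Each map of the path `ψ` sends positive elements to positive elements. -/
def IsPositivePath (ψ : Set.Ici (1 : ℝ) → A → B) : Prop :=
  ∀ t a, 0 ≤ a → 0 ≤ ψ t a

/-- A path `(ψ_t)`, `t ∈ [1, ∞)`, of (not necessarily linear) maps between C⋆-algebras is
*asymptotically completely positive*: it is a bounded continuous path at each element, each `ψ_t`
is selfadjoint, the path is asymptotically linear, and for every `n` and every positive `M` in
`M_n(A)` the negative part of the amplification `ψ_t^{(n)}(M)` tends to zero in norm. Pointwise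
boundedness and asymptotic linearity say that `a ↦ [t ↦ ψ_t(a)]` is a linear map into
`C_b([1, ∞), B) / C_0([1, ∞), B)`. Since `ψ_t` is selfadjoint, `ψ_t^{(n)}(M)` is selfadjoint, so its
negative part is the genuine one. -/
structure IsAsymptoticallyCP (ψ : Set.Ici (1 : ℝ) → A → B) : Prop where
  continuous_path : ∀ a, Continuous fun t => ψ t a
  bounded : ∀ a, ∃ C : ℝ, ∀ t, ‖ψ t a‖ ≤ C
  map_star : ∀ t a, ψ t (star a) = star (ψ t a)
  asymptotically_linear : ∀ (μ ν : ℂ) (a b : A),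
    Tendsto (fun t => ‖ψ t (μ • a + ν • b) - μ • ψ t a - ν • ψ t b‖) atTop (𝓝 0)
  asymptotically_positive : ∀ (n : ℕ) (M : CStarMatrix (Fin n) (Fin n) A), 0 ≤ M →
    Tendsto (fun t => ‖cstarNegPart (M.map (ψ t))‖) atTop (𝓝 0)

/-- A completely positive map is *order zero* if it preserves orthogonality of positive
elements. -/
def IsOrderZero (φ : A →CP Q) : Prop :=
  ∀ a b : A, 0 ≤ a → 0 ≤ b → a * b = 0 → φ a * φ b = 0

/-- A path of maps is *asymptotically order zero* if it asymptotically preserves orthogonality of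
positive elements. -/
def IsAsymptoticallyOrderZero (ψ : Set.Ici (1 : ℝ) → A → B) : Prop :=
  ∀ a b : A, 0 ≤ a → 0 ≤ b → a * b = 0 → Tendsto (fun t => ‖ψ t a * ψ t b‖) atTop (𝓝 0)

end Paths

section Equivariance

variable {G A B : Type*} [Group G] [TopologicalSpace G] [NonUnitalCStarAlgebra A]
  [NonUnitalCStarAlgebra B]

/-- The action `α` of `G` by ⋆-automorphisms of `A` is point-norm continuous, i.e. it makes `A` a
`G`-algebra. -/
def IsContinuousAction (α : G →* (A ≃⋆ₐ[ℂ] A)) : Prop :=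
  ∀ a, Continuous fun g => α g a

/-- A path of maps is *asymptotically equivariant* if, for each `a`, the difference
`g ψ_t(a) - ψ_t(g a)` tends to zero uniformly for `g` in compact subsets of `G`. -/
def IsAsymptoticallyEquivariant (α : G →* (A ≃⋆ₐ[ℂ] A)) (β : G →* (B ≃⋆ₐ[ℂ] B))
    (ψ : Set.Ici (1 : ℝ) → A → B) : Prop :=
  ∀ (a : A) (K : Set G), IsCompact K →
    TendstoUniformlyOn (fun t g => ‖β g (ψ t a) - ψ t (α g a)‖) (fun _ => (0 : ℝ)) atTop K

end Equivariance

/-!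
The lift `ψ` is compressed to `(1 - u_t) ψ_t(·) (1 - u_t)`, where `(u_t)` is a continuous path of
positive contractions in `ker π`. This leaves `π ∘ ψ_t` unchanged, and it brings the norms of
products and of equivariance defects down to the quotient norms as soon as `(u_t)` is asymptotically
`G`-invariant, asymptotically commutes with the values of `ψ`, and is asymptotically a quotient-norm
approximate unit for countably many paths built from `ψ` and a dense sequence of `A`. Elements of
`ker π` with these properties are averages of approximate units chosen almost orthogonally, and a
partition of unity joins them to a path.

Since `a ↦ ψ_t(a)` need not be continuous, and is only Lipschitz up to an error depending on the two
points, the compressed path controls only countably many elements. A continuous selection replaces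
it by a lift that is asymptotic to it locally uniformly in `a`, which carries the estimates over to
all of `A`. Cutting off norms and taking positive parts are compatible with `π` and do not change
the asymptotics, so the new path can moreover be made contractive, selfadjoint and positive.
-/

section NegPart

variable {E : Type*} [NonUnitalCStarAlgebra E] [PartialOrder E] [StarOrderedRing E]

theorem norm_negPart_le_of_neg_le {x z : E} (hx : IsSelfAdjoint x) (h : -z ≤ x) : ‖x⁻‖ ≤ ‖z‖ := by
  have hz : IsSelfAdjoint z := by
    simpa using (IsSelfAdjoint.of_nonneg (neg_le_iff_add_nonneg'.mp h)).sub hx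
  have hle : algebraMap ℝ (Unitization ℂ E) (-‖z‖) ≤ x := by
    have hz' : (z : Unitization ℂ E) ≤ algebraMap ℝ (Unitization ℂ E) ‖z‖ := by
      simpa [Unitization.norm_inr] using (hz.inr ℂ).le_algebraMap_norm_self
    rw [map_neg]
    refine (neg_le_neg hz').trans ?_
    rw [← sub_nonneg] at h ⊢
    simpa using Unitization.inr_nonneg_iff.mpr h
  refine norm_cfcₙ_le fun r hr => ?_
  rw [Unitization.quasispectrum_eq_spectrum_inr' ℝ ℂ] at hr
  have hr' : -‖z‖ ≤ r := (algebraMap_le_iff_le_spectrum (ha := hx.inr ℂ)).mp hle r hr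
  rw [Real.norm_eq_abs, abs_of_nonneg (negPart_nonneg r), negPart_def]
  exact sup_le (neg_le.mp hr') (norm_nonneg z)

theorem norm_negPart_le_add {x y : E} (hx : IsSelfAdjoint x) (hy : IsSelfAdjoint y) :
    ‖x⁻‖ ≤ ‖y⁻‖ + ‖x - y‖ := by
  have h : -(y⁻ + (x - y)⁻) ≤ x :=
    calc -(y⁻ + (x - y)⁻) = -y⁻ + -(x - y)⁻ := neg_add _ _
      _ ≤ y + (x - y) := add_le_add (CFC.neg_negPart_le hy) (CFC.neg_negPart_le (hx.sub hy))
      _ = x := add_sub_cancel y x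
  calc ‖x⁻‖ ≤ ‖y⁻ + (x - y)⁻‖ := norm_negPart_le_of_neg_le hx h
    _ ≤ ‖y⁻‖ + ‖(x - y)⁻‖ := norm_add_le _ _
    _ ≤ ‖y⁻‖ + ‖x - y‖ := by gcongr; exact CStarAlgebra.norm_negPart_le _

theorem norm_le_norm_add_add_norm_negPart {x y : E} (hx : IsSelfAdjoint x)
    (hy : IsSelfAdjoint y) : ‖x‖ ≤ ‖x + y‖ + 2 * ‖x⁻‖ + ‖y⁻‖ := by
  have hx' : 0 ≤ x + x⁻ := neg_le_iff_add_nonneg.mp (CFC.neg_negPart_le hx)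
  have hle : x + x⁻ ≤ x + y + y⁻ + x⁻ := by
    have hy' : 0 ≤ y + y⁻ := neg_le_iff_add_nonneg.mp (CFC.neg_negPart_le hy)
    calc x + x⁻ ≤ x + x⁻ + (y + y⁻) := le_add_of_nonneg_right hy'
      _ = x + y + y⁻ + x⁻ := by abel
  calc ‖x‖ = ‖x + x⁻ - x⁻‖ := by rw [add_sub_cancel_right]
    _ ≤ ‖x + x⁻‖ + ‖x⁻‖ := norm_sub_le _ _
    _ ≤ ‖x + y + y⁻ + x⁻‖ + ‖x⁻‖ := by
      gcongr; exact CStarAlgebra.norm_le_norm_of_nonneg_of_le hx' hle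
    _ ≤ ‖x + y‖ + ‖y⁻‖ + ‖x⁻‖ + ‖x⁻‖ := by gcongr; exact norm_add₃_le
    _ = ‖x + y‖ + 2 * ‖x⁻‖ + ‖y⁻‖ := by ring

end NegPart

section Conjugate

variable {R : Type*} [NonUnitalSeminormedRing R]

theorem norm_conjugate_mul_conjugate_le {v : R} (hv : ‖v‖ ≤ 1) (x y : R) :
    ‖v * x * v * (v * y * v)‖ ≤ ‖x * y * v‖ + 2 * ‖x‖ * ‖v * y - y * v‖ := by
  have key : v * x * v * (v * y * v) = v * (x * y * v) * (v * v) +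
      (v * (x * (v * y - y * v)) * (v * v) + v * x * v * (v * y - y * v) * v) := by noncomm_ring
  have h₁ (a : R) : ‖a * v‖ ≤ ‖a‖ :=
    (norm_mul_le a v).trans (mul_le_of_le_one_right (norm_nonneg a) hv)
  have h₂ (a : R) : ‖v * a‖ ≤ ‖a‖ :=
    (norm_mul_le v a).trans (mul_le_of_le_one_left (norm_nonneg a) hv)
  have h₃ (a : R) : ‖v * a * (v * v)‖ ≤ ‖a‖ := by
    simpa only [mul_assoc] using (h₁ _).trans ((h₁ _).trans (h₂ a))
  calc ‖v * x * v * (v * y * v)‖ ≤ ‖v * (x * y * v) * (v * v)‖ +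
        (‖v * (x * (v * y - y * v)) * (v * v)‖ + ‖v * x * v * (v * y - y * v) * v‖) := by
        rw [key]; exact (norm_add_le _ _).trans (by gcongr; exact norm_add_le _ _)
    _ ≤ ‖x * y * v‖ + (‖x‖ * ‖v * y - y * v‖ + ‖x‖ * ‖v * y - y * v‖) := by
      gcongr
      · exact h₃ _
      · exact (h₃ _).trans (norm_mul_le _ _)
      · exact (h₁ _).trans (norm_mul_le_of_le ((h₁ _).trans (h₂ x)) le_rfl)
    _ = ‖x * y * v‖ + 2 * ‖x‖ * ‖v * y - y * v‖ := by ring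

theorem norm_conjugate_sub_conjugate_le {v v' : R} (hv : ‖v‖ ≤ 1) (hv' : ‖v'‖ ≤ 1) (x : R) :
    ‖v * x * v - v' * x * v'‖ ≤ 2 * ‖v - v'‖ * ‖x‖ := by
  have key : v * x * v - v' * x * v' = (v - v') * x * v + v' * x * (v - v') := by noncomm_ring
  calc ‖v * x * v - v' * x * v'‖ ≤ ‖(v - v') * x * v‖ + ‖v' * x * (v - v')‖ := by
        rw [key]; exact norm_add_le _ _
    _ ≤ ‖v - v'‖ * ‖x‖ * 1 + 1 * ‖x‖ * ‖v - v'‖ := by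
        gcongr
        · exact norm_mul_le_of_le (norm_mul_le _ _) hv
        · exact norm_mul_le_of_le (norm_mul_le_of_le hv' le_rfl) le_rfl
    _ = 2 * ‖v - v'‖ * ‖x‖ := by ring

end Conjugate

section Compress

variable {E : Type*} [NonUnitalCStarAlgebra E]

/-- The compression `(1 - u) x (1 - u)`, written without a unit. -/
def compress (u x : E) : E := (x - u * x) - (x - u * x) * u

theorem inr_compress (u x : E) :
    ((compress u x : E) : Unitization ℂ E) = (1 - (u : Unitization ℂ E)) * x * (1 - u) := by
  simp only [compress, Unitization.inr_sub, Unitization.inr_mul]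
  noncomm_ring

theorem compress_add (u x y : E) : compress u (x + y) = compress u x + compress u y := by
  simp only [compress, mul_add, add_mul, sub_mul]; abel

theorem compress_sub (u x y : E) : compress u (x - y) = compress u x - compress u y := by
  simp only [compress, mul_sub, sub_mul]; abel

theorem compress_smul (u x : E) (c : ℂ) : compress u (c • x) = c • compress u x := by
  simp only [compress, mul_smul_comm, smul_mul_assoc, smul_sub, sub_mul]

theorem map_compress {F : Type*} [NonUnitalCStarAlgebra F] {𝓕 : Type*} [FunLike 𝓕 E F]
    [NonUnitalRingHomClass 𝓕 E F] (f : 𝓕) (u x : E) :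
    f (compress u x) = compress (f u) (f x) := by
  simp only [compress, map_sub, map_mul]

theorem compress_zero_left (x : E) : compress 0 x = x := by
  simp only [compress, zero_mul, mul_zero, sub_zero]

theorem star_compress {u : E} (hu : IsSelfAdjoint u) (x : E) :
    star (compress u x) = compress u (star x) := by
  simp only [compress, star_sub, star_mul, hu.star_eq, sub_mul, mul_assoc]; abel

variable [PartialOrder E] [StarOrderedRing E]

theorem norm_one_sub_inr_le {u : E} (hu : 0 ≤ u) (hu1 : ‖u‖ ≤ 1) :
    ‖1 - (u : Unitization ℂ E)‖ ≤ 1 := by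
  have h0 : (0 : Unitization ℂ E) ≤ u := Unitization.inr_nonneg_iff.mpr hu
  have h1 : (u : Unitization ℂ E) ≤ 1 := by
    rwa [← CStarAlgebra.norm_le_one_iff_of_nonneg _ h0, Unitization.norm_inr]
  rw [CStarAlgebra.norm_le_one_iff_of_nonneg _ (sub_nonneg.mpr h1)]
  exact sub_le_self 1 h0

theorem norm_sub_right_mul_le {u : E} (hu : 0 ≤ u) (hu1 : ‖u‖ ≤ 1) (x : E) : ‖x - x * u‖ ≤ ‖x‖ := by
  have h : ((x - x * u : E) : Unitization ℂ E) = x * (1 - u) := by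
    rw [Unitization.inr_sub, Unitization.inr_mul, mul_sub, mul_one]
  rw [← Unitization.norm_inr (𝕜 := ℂ) (x - x * u), ← Unitization.norm_inr (𝕜 := ℂ) x, h]
  exact norm_mul_le_of_le le_rfl (norm_one_sub_inr_le hu hu1) |>.trans_eq (mul_one _)

theorem norm_compress_le_sub {u : E} (hu : 0 ≤ u) (hu1 : ‖u‖ ≤ 1) (x : E) :
    ‖compress u x‖ ≤ ‖x - x * u‖ := by
  have h : compress u x = star (star (x - x * u) - star (x - x * u) * u) := by
    simp only [compress, star_sub, star_mul, star_star, hu.isSelfAdjoint.star_eq, sub_mul,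
      mul_assoc]
    abel
  rw [h, norm_star, ← norm_star (x - x * u)]
  exact norm_sub_right_mul_le hu hu1 _

theorem norm_compress_le {u : E} (hu : 0 ≤ u) (hu1 : ‖u‖ ≤ 1) (x : E) : ‖compress u x‖ ≤ ‖x‖ :=
  (norm_compress_le_sub hu hu1 x).trans (norm_sub_right_mul_le hu hu1 x)

theorem compress_nonneg {u x : E} (hu : IsSelfAdjoint u) (hx : 0 ≤ x) : 0 ≤ compress u x := by
  have hs : star (1 - (u : Unitization ℂ E)) = 1 - u := by
    rw [star_sub, star_one, ← Unitization.inr_star, hu.star_eq]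
  have h := star_left_conjugate_nonneg (Unitization.inr_nonneg_iff.mpr hx)
    (1 - (u : Unitization ℂ E))
  rwa [hs, ← inr_compress, Unitization.inr_nonneg_iff] at h

theorem norm_negPart_compress_le {u x : E} (hu : 0 ≤ u) (hu1 : ‖u‖ ≤ 1) (hx : IsSelfAdjoint x) :
    ‖(compress u x)⁻‖ ≤ ‖x⁻‖ := by
  have hs : IsSelfAdjoint (compress u x) := by
    rw [IsSelfAdjoint, star_compress hu.isSelfAdjoint, hx.star_eq]
  have hle : -compress u x⁻ ≤ compress u x := by
    rw [neg_le_iff_add_nonneg, ← compress_add]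
    exact compress_nonneg hu.isSelfAdjoint (neg_le_iff_add_nonneg.mp (CFC.neg_negPart_le hx))
  exact (norm_negPart_le_of_neg_le hs hle).trans (norm_compress_le hu hu1 _)

theorem norm_compress_mul_compress_le {u : E} (hu : 0 ≤ u) (hu1 : ‖u‖ ≤ 1) (x y : E) :
    ‖compress u x * compress u y‖ ≤ ‖x * y - x * y * u‖ + 2 * ‖x‖ * ‖u * y - y * u‖ := by
  have h := norm_conjugate_mul_conjugate_le (norm_one_sub_inr_le hu hu1)
    (x : Unitization ℂ E) (y : Unitization ℂ E)
  have hxy : (x : Unitization ℂ E) * y * (1 - u) = (x * y - x * y * u : E) := by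
    simp only [mul_sub, mul_one, Unitization.inr_sub, Unitization.inr_mul]
  have huy : (1 - (u : Unitization ℂ E)) * y - y * (1 - u) = -(u * y - y * u : E) := by
    rw [Unitization.inr_sub, Unitization.inr_mul, Unitization.inr_mul]; noncomm_ring
  rwa [hxy, huy, norm_neg, ← inr_compress, ← inr_compress, ← Unitization.inr_mul,
    Unitization.norm_inr, Unitization.norm_inr, Unitization.norm_inr, Unitization.norm_inr] at h

theorem norm_compress_sub_compress_le {u u' : E} (hu : 0 ≤ u) (hu1 : ‖u‖ ≤ 1) (hu' : 0 ≤ u')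
    (hu1' : ‖u'‖ ≤ 1) (x : E) : ‖compress u x - compress u' x‖ ≤ 2 * ‖u - u'‖ * ‖x‖ := by
  have h := norm_conjugate_sub_conjugate_le (norm_one_sub_inr_le hu hu1)
    (norm_one_sub_inr_le hu' hu1') (x : Unitization ℂ E)
  rwa [sub_sub_sub_cancel_left, ← inr_compress, ← inr_compress, ← Unitization.inr_sub,
    ← Unitization.inr_sub, Unitization.norm_inr, Unitization.norm_inr, Unitization.norm_inr,
    norm_sub_rev u' u] at h

end Compress

section Cutoff

/-- The function `s ↦ 1 - r / √s` for `s ≥ r ^ 2`, extended by `0`. Multiplying `x` by its value at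
`star x * x` removes the part of the polar decomposition of `x` above `r`. -/
noncomputable def cutoffFun (r s : ℝ) : ℝ := 1 - r / max (√s) r

theorem continuous_cutoffFun {r : ℝ} (hr : 0 < r) : Continuous (cutoffFun r) :=
  continuous_const.sub <| continuous_const.div (by fun_prop) fun _ =>
    (lt_max_of_lt_right hr).ne'

theorem cutoffFun_zero {r : ℝ} (hr : 0 < r) : cutoffFun r 0 = 0 := by
  rw [cutoffFun, Real.sqrt_zero, max_eq_right hr.le, div_self hr.ne', sub_self]

theorem sqrt_mul_cutoffFun {r : ℝ} (hr : 0 < r) (s : ℝ) :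
    √s * cutoffFun r s = max 0 (√s - r) := by
  rcases le_total (√s) r with h | h
  · rw [cutoffFun, max_eq_right h, div_self hr.ne', sub_self, mul_zero,
      max_eq_left (sub_nonpos.mpr h)]
  · have h0 : √s ≠ 0 := (hr.trans_le h).ne'
    rw [cutoffFun, max_eq_left h, max_eq_right (sub_nonneg.mpr h)]
    field_simp

variable {E F : Type*} [NonUnitalCStarAlgebra E] [NonUnitalCStarAlgebra F]

/-- The element `x` cut down to norm at most `r`: in terms of the polar decomposition
`x = v |x|`, this is `v min(|x|, r)`. -/
noncomputable def cutoff (r : ℝ) (x : E) : E :=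
  if 0 < r then x - x * cfcₙ (cutoffFun r) (star x * x) else 0

theorem map_cutoff (f : E →⋆ₙₐ[ℂ] F) (r : ℝ) (x : E) : f (cutoff r x) = cutoff r (f x) := by
  unfold cutoff
  split_ifs with h
  · have hs : IsSelfAdjoint (star x * x) := .star_mul_self x
    rw [map_sub, map_mul, NonUnitalStarAlgHom.map_cfcₙ f (cutoffFun r) (star x * x)
      (continuous_cutoffFun h).continuousOn (cutoffFun_zero h) (map_continuous f) hs (hs.map f),
      map_mul, map_star]
  · exact map_zero f

theorem continuous_cfcₙ_of_isSelfAdjoint {X : Type*} [TopologicalSpace X] {f : ℝ → ℝ}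
    (hf : Continuous f) (hf0 : f 0 = 0) {a : X → E} (ha : Continuous a)
    (has : ∀ x, IsSelfAdjoint (a x)) : Continuous fun x => cfcₙ f (a x) :=
  Continuous.cfcₙ_of_mem_nhdsSet (s := Set.univ) f univ_mem ha has

theorem continuous_cutoff (r : ℝ) : Continuous (cutoff r : E → E) := by
  unfold cutoff
  split_ifs with h
  · exact continuous_id.sub <| continuous_id.mul <| continuous_cfcₙ_of_isSelfAdjoint
      (continuous_cutoffFun h) (cutoffFun_zero h) (by fun_prop) fun x => .star_mul_self x
  · exact continuous_const

theorem map_posPart (f : E →⋆ₙₐ[ℂ] F) {x : E} (hx : IsSelfAdjoint x) : f x⁺ = (f x)⁺ := by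
  rw [CFC.posPart_def, CFC.posPart_def, NonUnitalStarAlgHom.map_cfcₙ f _ x (hφ := map_continuous f)]

variable [PartialOrder E] [StarOrderedRing E]

theorem nonneg_and_sqrt_le_of_mem_quasispectrum {x : E} {s : ℝ}
    (hs : s ∈ quasispectrum ℝ (star x * x)) : 0 ≤ s ∧ √s ≤ ‖x‖ := by
  refine ⟨quasispectrum_nonneg_of_nonneg _ (star_mul_self_nonneg x) s hs, ?_⟩
  have h := NonUnitalIsometricContinuousFunctionalCalculus.norm_quasispectrum_le (𝕜 := ℝ)
    (star x * x) hs (.star_mul_self x)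
  rw [CStarRing.norm_star_mul_self, ← sq] at h
  exact Real.sqrt_le_iff.mpr ⟨norm_nonneg x, (le_abs_self s).trans h⟩

theorem norm_mul_cfcₙ_star_mul_self_le {f : ℝ → ℝ} (hf : Continuous f) (hf0 : f 0 = 0) {x : E}
    {c : ℝ} (hc : 0 ≤ c) (h : ∀ s, √s ≤ ‖x‖ → |√s * f s| ≤ c) :
    ‖x * cfcₙ f (star x * x)‖ ≤ c := by
  have hfs : IsSelfAdjoint (cfcₙ f (star x * x)) := cfcₙ_predicate f _
  have key : star (x * cfcₙ f (star x * x)) * (x * cfcₙ f (star x * x)) =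
      cfcₙ (fun s => f s * s * f s) (star x * x) := by
    rw [cfcₙ_mul (fun s => f s * s) f (star x * x), cfcₙ_mul f (fun s => s) (star x * x),
      cfcₙ_id' ℝ (star x * x), star_mul, hfs.star_eq]
    simp only [mul_assoc]
  refine (sq_le_sq₀ (norm_nonneg _) hc).mp ?_
  rw [sq, ← CStarRing.norm_star_mul_self, key]
  refine norm_cfcₙ_le fun s hs => ?_
  obtain ⟨hs0, hs1⟩ := nonneg_and_sqrt_le_of_mem_quasispectrum hs
  have e : f s * s * f s = (√s * f s) ^ 2 := by rw [mul_pow, Real.sq_sqrt hs0]; ring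
  rw [e, norm_pow]
  gcongr
  exact h s hs1

theorem norm_sub_mul_cfcₙ_star_mul_self_le {f : ℝ → ℝ} (hf : Continuous f) (hf0 : f 0 = 0) {x : E}
    {c : ℝ} (hc : 0 ≤ c) (h : ∀ s, √s ≤ ‖x‖ → |√s - √s * f s| ≤ c) :
    ‖x - x * cfcₙ f (star x * x)‖ ≤ c := by
  have hfs : IsSelfAdjoint (cfcₙ f (star x * x)) := cfcₙ_predicate f _
  have key : star (x - x * cfcₙ f (star x * x)) * (x - x * cfcₙ f (star x * x)) =
      cfcₙ (fun s => (s - f s * s) - (s - f s * s) * f s) (star x * x) := by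
    rw [cfcₙ_sub (fun s => s - f s * s) (fun s => (s - f s * s) * f s) (star x * x),
      cfcₙ_mul (fun s => s - f s * s) f (star x * x),
      cfcₙ_sub (fun s => s) (fun s => f s * s) (star x * x),
      cfcₙ_mul f (fun s => s) (star x * x), cfcₙ_id' ℝ (star x * x), star_sub, star_mul,
      hfs.star_eq]
    noncomm_ring
  refine (sq_le_sq₀ (norm_nonneg _) hc).mp ?_
  rw [sq, ← CStarRing.norm_star_mul_self, key]
  refine norm_cfcₙ_le fun s hs => ?_
  obtain ⟨hs0, hs1⟩ := nonneg_and_sqrt_le_of_mem_quasispectrum hs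
  have e : (s - f s * s) - (s - f s * s) * f s = (√s - √s * f s) ^ 2 := by
    linear_combination -(1 - f s) ^ 2 * Real.sq_sqrt hs0
  rw [e, norm_pow]
  gcongr
  exact h s hs1

theorem norm_cutoff_le {r : ℝ} (hr : 0 ≤ r) (x : E) : ‖cutoff r x‖ ≤ r := by
  unfold cutoff
  split_ifs with h
  · refine norm_sub_mul_cfcₙ_star_mul_self_le (continuous_cutoffFun h) (cutoffFun_zero h) hr
      fun s _ => ?_
    rw [sqrt_mul_cutoffFun h, abs_le]
    grind [Real.sqrt_nonneg]
  · simpa only [norm_zero] using hr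

theorem norm_cutoff_sub_le {r : ℝ} (hr : 0 ≤ r) (x : E) :
    ‖cutoff r x - x‖ ≤ max 0 (‖x‖ - r) := by
  unfold cutoff
  split_ifs with h
  · rw [sub_sub_cancel_left, norm_neg]
    refine norm_mul_cfcₙ_star_mul_self_le (continuous_cutoffFun h) (cutoffFun_zero h)
      (le_max_left _ _) fun s hs => ?_
    rw [sqrt_mul_cutoffFun h, abs_of_nonneg (le_max_left _ _)]
    gcongr
  · rw [le_antisymm (not_lt.mp h) hr, zero_sub, norm_neg, sub_zero]
    exact le_max_right _ _

theorem cutoff_of_norm_le {r : ℝ} {x : E} (hx : ‖x‖ ≤ r) : cutoff r x = x := by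
  have h := norm_cutoff_sub_le ((norm_nonneg x).trans hx) x
  rw [max_eq_left (sub_nonpos.mpr hx)] at h
  exact sub_eq_zero.mp (norm_le_zero_iff.mp h)

theorem exists_map_eq_norm_le [PartialOrder F] [StarOrderedRing F] (f : E →⋆ₙₐ[ℂ] F) (x : E) :
    ∃ x', f x' = f x ∧ ‖x'‖ ≤ ‖f x‖ :=
  ⟨cutoff ‖f x‖ x, by rw [map_cutoff, cutoff_of_norm_le le_rfl], norm_cutoff_le (norm_nonneg _) x⟩

end Cutoff

section Averaging

variable {D : Type*} [NonUnitalNormedRing D] [StarRing D] [CStarRing D]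

theorem norm_add_sq_le_of_star_mul (x y : D) :
    ‖x + y‖ ^ 2 ≤ ‖x‖ ^ 2 + ‖y‖ ^ 2 + 2 * ‖star x * y‖ := by
  have h : ‖star y * x‖ = ‖star x * y‖ := by rw [← norm_star, star_mul, star_star]
  calc ‖x + y‖ ^ 2 = ‖star x * x + star y * y + (star x * y + star y * x)‖ := by
        rw [sq, ← CStarRing.norm_star_mul_self, star_add]; congr 1; noncomm_ring
    _ ≤ ‖star x * x‖ + ‖star y * y‖ + (‖star x * y‖ + ‖star y * x‖) :=
        (norm_add_le _ _).trans (add_le_add (norm_add_le _ _) (norm_add_le _ _))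
    _ = ‖x‖ ^ 2 + ‖y‖ ^ 2 + 2 * ‖star x * y‖ := by
        rw [CStarRing.norm_star_mul_self, CStarRing.norm_star_mul_self, h]; ring

variable [NormedSpace ℝ D] [SMulCommClass ℝ D D]

theorem mul_norm_weighted_average_sq_le {n C : ℝ} (hn : 0 < n) {x y : D} (hx : n * ‖x‖ ^ 2 ≤ C)
    (hy : ‖y‖ ^ 2 + 2 ≤ C) (hxy : n * ‖star x * y‖ ≤ 1) :
    (n + 1) * ‖(n / (n + 1)) • x + (1 / (n + 1)) • y‖ ^ 2 ≤ C := by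
  have hsum : (n / (n + 1)) • x + (1 / (n + 1)) • y = (1 / (n + 1)) • (n • x + y) := by
    rw [smul_add, smul_smul, one_div_mul_eq_div]
  have hstar : ‖star y * (n • x)‖ = n * ‖star x * y‖ := by
    rw [mul_smul_comm, norm_smul, Real.norm_of_nonneg hn.le, ← norm_star (star x * y), star_mul,
      star_star]
  have hsq : ‖n • x + y‖ ^ 2 ≤ (n + 1) * C :=
    calc ‖n • x + y‖ ^ 2 ≤ ‖y‖ ^ 2 + ‖n • x‖ ^ 2 + 2 * ‖star y * (n • x)‖ := by
          rw [add_comm]; exact norm_add_sq_le_of_star_mul _ _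
      _ = n * (n * ‖x‖ ^ 2) + ‖y‖ ^ 2 + 2 * (n * ‖star x * y‖) := by
          rw [hstar, norm_smul, Real.norm_of_nonneg hn.le]; ring
      _ ≤ n * C + ‖y‖ ^ 2 + 2 * 1 := by gcongr
      _ ≤ (n + 1) * C := by linarith
  rw [hsum, norm_smul, Real.norm_of_nonneg (by positivity), mul_pow]
  calc (n + 1) * ((1 / (n + 1)) ^ 2 * ‖n • x + y‖ ^ 2)
      ≤ (n + 1) * ((1 / (n + 1)) ^ 2 * ((n + 1) * C)) := by gcongr
    _ = C := by field_simp

variable {V : Type*} [AddCommGroup V] [Module ℝ V]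

/-- Successive points are chosen almost orthogonal to the average of the earlier ones, so that the
norm of the sum of `k` points only grows like `√k`. -/
theorem exists_mem_forall_norm_apply_le {𝒯 : Set (V →ₗ[ℝ] D)} {s : Set V} (hs : Convex ℝ s)
    (hne : s.Nonempty) {M : ℝ} (hM : ∀ T ∈ 𝒯, ∀ e ∈ s, ‖T e‖ ≤ M)
    (horth : ∀ e ∈ s, ∀ δ > 0, ∃ e' ∈ s, ∀ T ∈ 𝒯, ‖star (T e) * T e'‖ ≤ δ) {ε : ℝ} (hε : 0 < ε) :
    ∃ e ∈ s, ∀ T ∈ 𝒯, ‖T e‖ ≤ ε := by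
  have hM2 : ∀ T ∈ 𝒯, ∀ e ∈ s, ‖T e‖ ^ 2 ≤ M ^ 2 := fun T hT e he => by
    gcongr; exact hM T hT e he
  have average (k : ℕ) : ∃ e ∈ s, ∀ T ∈ 𝒯, (k + 1) * ‖T e‖ ^ 2 ≤ M ^ 2 + 2 := by
    induction k with
    | zero =>
      refine hne.imp fun e he => ⟨he, fun T hT => ?_⟩
      push_cast; linarith [hM2 T hT e he]
    | succ k ih =>
      obtain ⟨e, he, hTe⟩ := ih
      obtain ⟨e', he', horth'⟩ := horth e he (1 / (k + 1)) (by positivity)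
      have hk : (0 : ℝ) < k + 1 := by positivity
      refine ⟨((k + 1 : ℝ) / (k + 1 + 1)) • e + ((1 : ℝ) / (k + 1 + 1)) • e',
        hs he he' (by positivity) (by positivity) (by field_simp), fun T hT => ?_⟩
      rw [map_add, map_smul, map_smul, Nat.cast_succ]
      refine mul_norm_weighted_average_sq_le hk (hTe T hT)
        (add_le_add (hM2 T hT e' he') le_rfl) ?_
      exact (le_div_iff₀' hk).mp (horth' T hT)
  obtain ⟨k, hk⟩ := exists_nat_gt ((M ^ 2 + 2) / ε ^ 2)
  obtain ⟨e, he, hTe⟩ := average k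
  refine ⟨e, he, fun T hT => (sq_le_sq₀ (norm_nonneg _) hε.le).mp ?_⟩
  have hkε : M ^ 2 + 2 < (k + 1) * ε ^ 2 :=
    ((div_lt_iff₀ (by positivity)).mp hk).trans_le (by gcongr; linarith)
  exact le_of_mul_le_mul_left ((hTe T hT).trans hkε.le) (by positivity)

end Averaging

section Ideal

variable {B Q : Type*} [NonUnitalCStarAlgebra B] [NonUnitalCStarAlgebra Q]

theorem convex_setOf_map_eq (π : B →⋆ₙₐ[ℂ] Q) (q : Q) : Convex ℝ {b | π b = q} :=
  fun x hx y hy r s _ _ hrs => by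
    rw [Set.mem_ofPred, map_add, map_real_smul π (map_continuous π),
      map_real_smul π (map_continuous π), hx, hy, ← add_smul, hrs, one_smul]

variable [PartialOrder B] [StarOrderedRing B]

/-- The positive contractions in the ideal `ker π`. -/
def idealContractions (π : B →⋆ₙₐ[ℂ] Q) : Set B := {e | 0 ≤ e ∧ ‖e‖ ≤ 1 ∧ π e = 0}

theorem convex_idealContractions (π : B →⋆ₙₐ[ℂ] Q) : Convex ℝ (idealContractions π) := by
  rintro e ⟨he0, he1, heπ⟩ e' ⟨he0', he1', heπ'⟩ s t hs ht hst
  refine ⟨add_nonneg (smul_nonneg hs he0) (smul_nonneg ht he0'), ?_, ?_⟩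
  · simpa using convex_closedBall (0 : B) 1 (by simpa using he1) (by simpa using he1') hs ht hst
  · exact convex_setOf_map_eq π 0 heπ heπ' hs ht hst

theorem exists_approximateUnit_idealContractions (π : B →⋆ₙₐ[ℂ] Q) :
    ∃ l : Filter B, l.NeBot ∧ (∀ᶠ e in l, e ∈ idealContractions π) ∧
      ∀ c, π c = 0 → Tendsto (fun e => c * e) l (𝓝 c) := by
  let J : NonUnitalStarSubalgebra ℂ B := NonUnitalStarAlgHom.equalizer π 0
  have : IsClosed (J : Set B) :=
    isClosed_eq (map_continuous π) continuous_const
  let _ : PartialOrder J := CStarAlgebra.spectralOrder J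
  have : StarOrderedRing J := CStarAlgebra.spectralOrderedRing J
  have hl := CStarAlgebra.increasingApproximateUnit J
  refine ⟨(CStarAlgebra.approximateUnit J).map (↑), inferInstance, ?_, fun c hc => ?_⟩
  · rw [eventually_map]
    filter_upwards [hl.eventually_nonneg, hl.eventually_norm] with e he0 he1
    obtain ⟨b, rfl⟩ := CStarAlgebra.nonneg_iff_eq_star_mul_self.mp he0
    exact ⟨star_mul_self_nonneg (b : B), he1, (star b * b).2⟩
  · exact (continuous_subtype_val.tendsto (⟨c, hc⟩ : J)).comp (hl.tendsto_mul_left ⟨c, hc⟩)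

variable [PartialOrder Q] [StarOrderedRing Q]

theorem exists_mem_idealContractions_forall_norm_sub_mul_le (π : B →⋆ₙₐ[ℂ] Q) {L : Set B}
    (hL : IsCompact L) {ε : ℝ} (hε : 0 < ε) :
    ∃ e ∈ idealContractions π, ∀ x ∈ L, ‖x - x * e‖ ≤ ‖π x‖ + ε := by
  obtain ⟨l, _, hl, hlim⟩ := exists_approximateUnit_idealContractions π
  have hloc (x : B) : ∀ᶠ e in l, ∀ y ∈ Metric.ball x (ε / 3), ‖y - y * e‖ ≤ ‖π y‖ + ε := by
    obtain ⟨x', hx', hle⟩ := exists_map_eq_norm_le π x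
    have hc : Tendsto (fun e => (x - x') - (x - x') * e) l (𝓝 0) := by
      simpa using (hlim (x - x') (by rw [map_sub, hx', sub_self])).const_sub (x - x')
    filter_upwards [hl, hc.norm.eventually_lt_const (u := ε / 3) (by simpa)]
      with e ⟨he0, he1, _⟩ hce y hy
    rw [mem_ball_iff_norm] at hy
    have hπ : ‖π x‖ ≤ ‖π y‖ + ‖y - x‖ := by
      have h := NonUnitalStarAlgHom.norm_apply_le π (y - x)
      rw [map_sub] at h
      linarith [norm_sub_norm_le (π x) (π y), norm_sub_rev (π x) (π y)]
    calc ‖y - y * e‖ = ‖((y - x) - (y - x) * e) + (((x - x') - (x - x') * e) + (x' - x' * e))‖ := by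
          congr 1; noncomm_ring
      _ ≤ ‖y - x‖ + (‖(x - x') - (x - x') * e‖ + ‖x'‖) :=
          norm_add_le_of_le (norm_sub_right_mul_le he0 he1 _)
            (norm_add_le_of_le le_rfl (norm_sub_right_mul_le he0 he1 _))
      _ ≤ ‖π y‖ + ε := by linarith
  have hall : ∀ᶠ e in l, ∀ x ∈ L, ‖x - x * e‖ ≤ ‖π x‖ + ε := by
    refine hL.induction_on (p := fun s => ∀ᶠ e in l, ∀ x ∈ s, ‖x - x * e‖ ≤ ‖π x‖ + ε)
      (by simp) (fun s t hst ht => ht.mono fun e he x hx => he x (hst hx))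
      (fun s t hs ht => ?_) fun x _ =>
        ⟨_, mem_nhdsWithin_of_mem_nhds (Metric.ball_mem_nhds x (by positivity)), hloc x⟩
    filter_upwards [hs, ht] with e hse hte x hx
    exact hx.elim (hse x) (hte x)
  exact (hl.and hall).exists

end Ideal

section Quasicentral

variable {G B Q : Type*} [Group G] [NonUnitalCStarAlgebra B]

/-- The linear map `e ↦ g e - e`. -/
noncomputable def displacement (β : G →* (B ≃⋆ₐ[ℂ] B)) (g : G) : B →ₗ[ℝ] B where
  toFun e := β g e - e
  map_add' e e' := by rw [map_add]; abel
  map_smul' r e := by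
    rw [← Complex.coe_smul, map_smul, ← smul_sub, Complex.coe_smul, RingHom.id_apply]

/-- The linear map `e ↦ e x - x e`. -/
noncomputable def commutatorMap (x : B) : B →ₗ[ℝ] B :=
  LinearMap.mulRight ℝ x - LinearMap.mulLeft ℝ x

theorem norm_displacement_le (β : G →* (B ≃⋆ₐ[ℂ] B)) (g : G) (e : B) :
    ‖displacement β g e‖ ≤ 2 * ‖e‖ := by
  refine (norm_sub_le _ _).trans_eq ?_
  rw [StarAlgEquiv.norm_map, two_mul]

theorem norm_commutatorMap_le (x e : B) : ‖commutatorMap x e‖ ≤ 2 * ‖x‖ * ‖e‖ :=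
  calc ‖e * x - x * e‖ ≤ ‖e‖ * ‖x‖ + ‖x‖ * ‖e‖ :=
        norm_sub_le_of_le (norm_mul_le e x) (norm_mul_le x e)
    _ = 2 * ‖x‖ * ‖e‖ := by ring

theorem apply_apply_inv (β : G →* (B ≃⋆ₐ[ℂ] B)) (g : G) (b : B) : β g (β g⁻¹ b) = b := by
  rw [map_inv]; exact (β g).apply_symm_apply b

theorem norm_mul_displacement_le (β : G →* (B ≃⋆ₐ[ℂ] B)) (g : G) (c e : B) :
    ‖c * displacement β g e‖ ≤ ‖c - c * e‖ + ‖β g⁻¹ c - β g⁻¹ c * e‖ := by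
  calc ‖c * displacement β g e‖ = ‖(c - c * e) - β g (β g⁻¹ c - β g⁻¹ c * e)‖ := by
        rw [map_sub, map_mul, apply_apply_inv, displacement, LinearMap.coe_mk, AddHom.coe_mk]
        congr 1; noncomm_ring
    _ ≤ ‖c - c * e‖ + ‖β g⁻¹ c - β g⁻¹ c * e‖ := by
        rw [← StarAlgEquiv.norm_map (β g) (β g⁻¹ c - β g⁻¹ c * e)]; exact norm_sub_le _ _

theorem norm_mul_commutatorMap_le (x c e : B) :
    ‖c * commutatorMap x e‖ ≤ ‖c - c * e‖ * ‖x‖ + ‖c * x - c * x * e‖ :=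
  calc ‖c * (e * x - x * e)‖ = ‖(c * x - c * x * e) - (c - c * e) * x‖ := by
        congr 1; noncomm_ring
    _ ≤ ‖c - c * e‖ * ‖x‖ + ‖c * x - c * x * e‖ := by
        linarith [norm_sub_le (c * x - c * x * e) ((c - c * e) * x), norm_mul_le (c - c * e) x]

theorem convex_setOf_forall_norm_sub_mul_le (L : Set B) (r : B → ℝ) :
    Convex ℝ {e | ∀ x ∈ L, ‖x - x * e‖ ≤ r x} := by
  simp only [Set.ofPred_forall]
  refine convex_iInter₂ fun x _ => ?_
  have h := (convex_closedBall x (r x)).linear_preimage (LinearMap.mulLeft ℝ x)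
  simpa only [Set.preimage, mem_closedBall_iff_norm', LinearMap.mulLeft_apply] using h

/-- The linear maps whose simultaneous smallness at `e` says that `e` is almost fixed by `K` and
almost commutes with `L`. -/
def quasicentralityDefects (β : G →* (B ≃⋆ₐ[ℂ] B)) (K : Set G) (L : Set B) :
    Set (B →ₗ[ℝ] B) :=
  displacement β '' K ∪ commutatorMap '' L

theorem continuous_inv_apply [TopologicalSpace G] {β : G →* (B ≃⋆ₐ[ℂ] B)}
    (hβ : IsContinuousAction β) (b : B) : Continuous fun g => β g⁻¹ b := by
  refine continuous_iff_continuousAt.mpr fun g => tendsto_iff_norm_sub_tendsto_zero.mpr ?_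
  have h : Tendsto (fun h => ‖b - β h (β g⁻¹ b)‖) (𝓝 g) (𝓝 0) := by
    simpa only [apply_apply_inv, sub_self, norm_zero] using
      (((hβ (β g⁻¹ b)).tendsto g).const_sub b).norm
  refine h.congr fun h => ?_
  rw [← StarAlgEquiv.norm_map (β h) (β h⁻¹ b - β g⁻¹ b), map_sub, apply_apply_inv]

theorem IsContinuousAction.continuous_uncurry [TopologicalSpace G] {β : G →* (B ≃⋆ₐ[ℂ] B)}
    (hβ : IsContinuousAction β) : Continuous fun p : G × B => β p.1 p.2 :=
  continuous_prod_of_continuous_lipschitzWith' _ 1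
    (fun g => (StarAlgEquiv.isometry (β g)).lipschitz) hβ

variable [NonUnitalCStarAlgebra Q] [PartialOrder B]

/-- The elements which are, up to `ε`, a `K`-invariant approximate unit of the ideal `ker π` that
commutes with `L`. -/
def quasicentralSet (β : G →* (B ≃⋆ₐ[ℂ] B)) (π : B →⋆ₙₐ[ℂ] Q) (K : Set G) (L : Set B) (ε : ℝ) :
    Set B :=
  {e ∈ idealContractions π | (∀ x ∈ L, ‖x - x * e‖ ≤ ‖π x‖ + ε) ∧
    ∀ T ∈ quasicentralityDefects β K L, ‖T e‖ ≤ ε}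

theorem quasicentralSet_subset (β : G →* (B ≃⋆ₐ[ℂ] B)) (π : B →⋆ₙₐ[ℂ] Q) {K K' : Set G}
    (hK : K ⊆ K') {L L' : Set B} (hL : L ⊆ L') {ε ε' : ℝ} (hε : ε' ≤ ε) :
    quasicentralSet β π K' L' ε' ⊆ quasicentralSet β π K L ε := by
  rintro e ⟨he, hunit, hsmall⟩
  refine ⟨he, fun x hx => (hunit x (hL hx)).trans (by gcongr), fun T hT => ?_⟩
  exact (hsmall T (Set.union_subset_union (Set.image_mono hK) (Set.image_mono hL) hT)).trans hε

variable [StarOrderedRing B]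

theorem convex_quasicentralSet (β : G →* (B ≃⋆ₐ[ℂ] B)) (π : B →⋆ₙₐ[ℂ] Q) (K : Set G) (L : Set B)
    (ε : ℝ) : Convex ℝ (quasicentralSet β π K L ε) := by
  have hsmall : Convex ℝ {e | ∀ T ∈ quasicentralityDefects β K L, ‖T e‖ ≤ ε} := by
    simp only [Set.ofPred_forall]
    refine convex_iInter₂ fun T _ => ?_
    simpa only [Set.preimage, mem_closedBall_zero_iff] using
      (convex_closedBall (0 : B) ε).linear_preimage T
  exact (convex_idealContractions π).inter
    ((convex_setOf_forall_norm_sub_mul_le L _).inter hsmall)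

variable [TopologicalSpace G] [PartialOrder Q] [StarOrderedRing Q]

theorem exists_mem_idealContractions_forall_norm_star_mul_le {β : G →* (B ≃⋆ₐ[ℂ] B)}
    (hβ : IsContinuousAction β) (π : B →⋆ₙₐ[ℂ] Q) (hβπ : ∀ g b, π b = 0 → π (β g b) = 0)
    {K : Set G} (hK : IsCompact K) {L : Set B} (hL : IsCompact L) {e : B} (he : π e = 0)
    {ε : ℝ} (hε : 0 < ε) :
    ∃ e' ∈ idealContractions π, (∀ x ∈ L, ‖x - x * e'‖ ≤ ‖π x‖ + ε) ∧
      ∀ T ∈ quasicentralityDefects β K L, ‖star (T e) * T e'‖ ≤ ε := by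
  obtain ⟨R, hR0, hR⟩ := hL.isBounded.exists_pos_norm_le
  let P : Set B := ((fun g => star (β g e - e)) '' K ∪ (fun g => star (e - β g⁻¹ e)) '' K) ∪
    ((fun x => star (e * x - x * e)) '' L ∪ (fun x => star (e * x - x * e) * x) '' L)
  have hP : IsCompact P := by
    have hβe := hβ e
    exact ((hK.image (by fun_prop)).union
      (hK.image (continuous_const.sub (continuous_inv_apply hβ e)).star)).union
      ((hL.image (by fun_prop)).union (hL.image (by fun_prop)))
  have hPπ : ∀ c ∈ P, π c = 0 := by
    rintro c ((⟨g, -, rfl⟩ | ⟨g, -, rfl⟩) | ⟨x, -, rfl⟩ | ⟨x, -, rfl⟩) <;>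
      simp only [map_star, map_mul, map_sub, he, hβπ _ e he, zero_mul, mul_zero, sub_zero,
        star_zero]
  set η := min ε (ε / (R + 2))
  have hηε : η * (R + 2) ≤ ε := (le_div_iff₀ (by positivity)).mp (min_le_right _ _)
  have hη0 : 0 < η := lt_min hε (by positivity)
  obtain ⟨e', he', hunit⟩ :=
    exists_mem_idealContractions_forall_norm_sub_mul_le π (hL.union hP) hη0
  have hunitP : ∀ c ∈ P, ‖c - c * e'‖ ≤ η := fun c hc => by
    simpa [hPπ c hc] using hunit c (.inr hc)
  refine ⟨e', he', fun x hx => (hunit x (.inl hx)).trans (by gcongr; exact min_le_left _ _), ?_⟩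
  rintro T (⟨g, hg, rfl⟩ | ⟨x, hx, rfl⟩)
  · have hinv : β g⁻¹ (star (β g e - e)) = star (e - β g⁻¹ e) := by
      rw [map_star, map_sub, map_inv]; congr; exact (β g).symm_apply_apply e
    calc _ ≤ η + η := (norm_mul_displacement_le β g _ e').trans <| add_le_add
          (hunitP _ (.inl (.inl ⟨g, hg, rfl⟩)))
          (hinv ▸ hunitP _ (.inl (.inr ⟨g, hg, rfl⟩)))
      _ ≤ ε := by nlinarith
  · calc _ ≤ η * R + η := (norm_mul_commutatorMap_le x _ e').trans <| by
          gcongr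
          exacts [hunitP _ (.inr (.inl ⟨x, hx, rfl⟩)), hR x hx,
            hunitP _ (.inr (.inr ⟨x, hx, rfl⟩))]
      _ ≤ ε := by linarith

theorem quasicentralSet_nonempty {β : G →* (B ≃⋆ₐ[ℂ] B)} (hβ : IsContinuousAction β)
    (π : B →⋆ₙₐ[ℂ] Q) (hβπ : ∀ g b, π b = 0 → π (β g b) = 0) {K : Set G} (hK : IsCompact K)
    {L : Set B} (hL : IsCompact L) {ε : ℝ} (hε : 0 < ε) :
    (quasicentralSet β π K L ε).Nonempty := by
  obtain ⟨R, hR0, hR⟩ := hL.isBounded.exists_pos_norm_le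
  have hbound : ∀ T ∈ quasicentralityDefects β K L, ∀ e ∈ idealContractions π,
      ‖T e‖ ≤ 2 + 2 * R := by
    rintro T (⟨g, -, rfl⟩ | ⟨x, hx, rfl⟩) e ⟨-, he1, -⟩
    · linarith [norm_displacement_le β g e]
    · have := norm_commutatorMap_le x e
      nlinarith [hR x hx, norm_nonneg x]
  obtain ⟨e, ⟨he, hunit⟩, hsmall⟩ := exists_mem_forall_norm_apply_le
    (s := {e ∈ idealContractions π | ∀ x ∈ L, ‖x - x * e‖ ≤ ‖π x‖ + ε})
    ((convex_idealContractions π).inter (convex_setOf_forall_norm_sub_mul_le L _))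
    (exists_mem_idealContractions_forall_norm_sub_mul_le π hL hε)
    (fun T hT e he => hbound T hT e he.1)
    (fun e he δ hδ => by
      obtain ⟨e', he', hunit', horth⟩ := exists_mem_idealContractions_forall_norm_star_mul_le hβ π
        hβπ hK hL he.1.2.2 (lt_min hε hδ)
      exact ⟨e', ⟨he', fun x hx => (hunit' x hx).trans (by gcongr; exact min_le_left _ _)⟩,
        fun T hT => (horth T hT).trans (min_le_right _ _)⟩) hε
  exact ⟨e, he, hunit, hsmall⟩

end Quasicentral

section QuasicentralPath

theorem exists_continuous_forall_mem_floor {X E : Type*} [TopologicalSpace X] [NormalSpace X]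
    [ParacompactSpace X] [TopologicalSpace E] [AddCommGroup E] [ContinuousAdd E] [Module ℝ E]
    [ContinuousSMul ℝ E] {f : X → ℝ} (hf : Continuous f) {S : ℕ → Set E} (hanti : Antitone S)
    (hconv : ∀ n, Convex ℝ (S n)) (hne : ∀ n, (S n).Nonempty) :
    ∃ u : C(X, E), ∀ x, u x ∈ S ⌊f x⌋₊ := by
  refine exists_continuous_forall_mem_convex_of_local_const (fun x => hconv _) fun x => ?_
  refine (hne ⌊f x⌋₊).imp fun e he => ?_
  filter_upwards [hf.continuousAt.eventually_lt_const (Nat.lt_floor_add_one (f x))] with y hy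
  exact hanti (Nat.lt_succ_iff.mp <| (Nat.floor_lt' (Nat.succ_ne_zero _)).mpr (mod_cast hy)) he

variable {G B Q : Type*} [Group G] [TopologicalSpace G] [NonUnitalCStarAlgebra B] [PartialOrder B]
  [NonUnitalCStarAlgebra Q]

/-- A continuous path of positive contractions in `ker π` that is asymptotically invariant and,
along each `f ∈ F`, asymptotically commutes with `f` and computes the quotient norm of `f`. -/
structure IsQuasicentralPath (β : G →* (B ≃⋆ₐ[ℂ] B)) (π : B →⋆ₙₐ[ℂ] Q)
    (F : Set (Set.Ici (1 : ℝ) × G → B)) (u : Set.Ici (1 : ℝ) → B) : Prop where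
  continuous : Continuous u
  mem_idealContractions : ∀ t, u t ∈ idealContractions π
  eventually_mem_quasicentralSet : ∀ f ∈ F, ∀ g, ∀ ε > 0,
    ∀ᶠ p in atTop ×ˢ 𝓝 g, u p.1 ∈ quasicentralSet β π {p.2} {f p} ε

theorem exists_isQuasicentralPath [WeaklyLocallyCompactSpace G] [SigmaCompactSpace G]
    [StarOrderedRing B] [PartialOrder Q] [StarOrderedRing Q] {β : G →* (B ≃⋆ₐ[ℂ] B)}
    (hβ : IsContinuousAction β) (π : B →⋆ₙₐ[ℂ] Q) (hβπ : ∀ g b, π b = 0 → π (β g b) = 0)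
    {F : Set (Set.Ici (1 : ℝ) × G → B)} (hFc : ∀ f ∈ F, Continuous f) (hF : F.Countable) :
    ∃ u, IsQuasicentralPath β π F u := by
  obtain ⟨f, hf⟩ := Set.countable_iff_exists_subset_range.mp
    (hF.preimage (DFunLike.coe_injective (F := C(Set.Ici (1 : ℝ) × G, B))))
  let K : CompactExhaustion G := default
  let I (n : ℕ) : Set (Set.Ici (1 : ℝ)) := Subtype.val ⁻¹' Set.Icc 1 (n + 1 : ℝ)
  have hI (n : ℕ) : IsCompact (I n) :=
    isClosed_Ici.isClosedEmbedding_subtypeVal.isCompact_preimage isCompact_Icc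
  let L (n : ℕ) : Set B := ⋃ i ∈ Set.Iic n, f i '' (I n ×ˢ K n)
  have hL (n : ℕ) : IsCompact (L n) := (Set.finite_Iic n).isCompact_biUnion fun i _ =>
    ((hI n).prod (K.isCompact n)).image (f i).continuous
  have hLmono : Monotone L := fun m n hmn => by
    have hImn : I m ⊆ I n := Set.preimage_mono (Set.Icc_subset_Icc_right (by gcongr))
    exact Set.biUnion_mono (Set.Iic_subset_Iic.mpr hmn) fun i _ =>
      Set.image_mono (Set.prod_mono hImn (K.subset hmn))
  obtain ⟨u, hu⟩ := exists_continuous_forall_mem_floor (X := Set.Ici (1 : ℝ))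
    continuous_subtype_val (S := fun n => quasicentralSet β π (K n) (L n) (1 / (n + 1)))
    (fun m n hmn => quasicentralSet_subset β π (K.subset hmn) (hLmono hmn) (by gcongr))
    (fun n => convex_quasicentralSet β π _ _ _)
    fun n => quasicentralSet_nonempty hβ π hβπ (K.isCompact n) (hL n) (by positivity)
  refine ⟨u, u.continuous, fun t => (hu t).1, fun x hx g ε hε => ?_⟩
  obtain ⟨i, rfl⟩ : ∃ i, f i = x := (hf (a := ⟨x, hFc x hx⟩) hx).imp fun i hi => by rw [hi]; rfl
  obtain ⟨n, hn⟩ := K.exists_mem_nhds g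
  obtain ⟨m, hm⟩ := exists_nat_one_div_lt hε
  have hlarge : ∀ᶠ t : Set.Ici (1 : ℝ) in atTop, max i (max n m) ≤ ⌊(t : ℝ)⌋₊ :=
    (tendsto_nat_floor_atTop.comp (tendsto_Ici_atTop.mp tendsto_id)).eventually_ge_atTop _
  filter_upwards [hlarge.prod_mk hn] with ⟨t, h⟩ ⟨ht, hh⟩
  simp only [max_le_iff] at ht
  have hhK : h ∈ K ⌊(t : ℝ)⌋₊ := K.subset ht.2.1 hh
  refine quasicentralSet_subset β π (Set.singleton_subset_iff.mpr hhK)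
    (Set.singleton_subset_iff.mpr ?_) ?_ (hu t)
  · exact Set.mem_biUnion (Set.mem_Iic.mpr ht.1)
      ⟨(t, h), ⟨⟨t.2, (Nat.lt_floor_add_one _).le⟩, hhK⟩, rfl⟩
  · refine le_trans ?_ hm.le
    gcongr
    exact ht.2.2

end QuasicentralPath

section MonotoneSeminorm

variable {A : Type*} [NonUnitalCStarAlgebra A] [PartialOrder A] [StarOrderedRing A]

theorem exists_forall_nonneg_le_mul_norm_of_monotone (p : Seminorm ℂ A)
    (hp : ∀ a b, 0 ≤ a → a ≤ b → p a ≤ p b) : ∃ C, ∀ a, 0 ≤ a → p a ≤ C * ‖a‖ := by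
  by_contra! hcon
  choose a ha0 ha using fun n : ℕ => hcon (4 ^ n)
  have hnorm (n : ℕ) : 0 < ‖a n‖ := by
    refine norm_pos_iff.mpr fun h => (ha n).ne ?_
    rw [h, norm_zero, mul_zero, map_zero]
  let c (n : ℕ) : ℝ := (1 / 2) ^ n / ‖a n‖
  have hc (n : ℕ) : 0 < c n := div_pos (by positivity) (hnorm n)
  have hca (n : ℕ) : c n * ‖a n‖ = (1 / 2) ^ n := div_mul_cancel₀ _ (hnorm n).ne'
  have hsum : Summable fun n => c n • a n := by
    refine summable_geometric_two.of_norm_bounded fun n => ?_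
    rw [norm_smul, Real.norm_of_nonneg (hc n).le, hca]
  have hnonneg (n : ℕ) : 0 ≤ c n • a n := smul_nonneg (hc n).le (ha0 n)
  obtain ⟨n, hn⟩ := pow_unbounded_of_one_lt (p (∑' n, c n • a n)) (one_lt_two (α := ℝ))
  refine (hn.trans ?_).not_ge (hp _ _ (hnonneg n) (hsum.le_tsum n fun j _ => hnonneg j))
  calc (2 : ℝ) ^ n = c n * (4 ^ n * ‖a n‖) := by
        rw [mul_left_comm, hca, ← mul_pow]; norm_num
    _ < c n * p (a n) := mul_lt_mul_of_pos_left (ha n) (hc n)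
    _ = p (c n • a n) := by
        rw [← Complex.coe_smul, map_smul_eq_mul, Complex.norm_of_nonneg (hc n).le]

theorem exists_le_mul_norm_of_monotone (p : Seminorm ℂ A)
    (hp : ∀ a b, 0 ≤ a → a ≤ b → p a ≤ p b) : ∃ C, ∀ a, p a ≤ C * ‖a‖ := by
  obtain ⟨C, hC⟩ := exists_forall_nonneg_le_mul_norm_of_monotone p hp
  refine ⟨4 * |C|, fun a => ?_⟩
  obtain ⟨x, hx, hxn, hxa⟩ := CStarAlgebra.exists_sum_four_nonneg a
  have hpx (i : Fin 4) : p (Complex.I ^ (i : ℕ) • x i) ≤ |C| * ‖a‖ :=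
    calc p (Complex.I ^ (i : ℕ) • x i) = p (x i) := by
          rw [map_smul_eq_mul, norm_pow, Complex.norm_I, one_pow, one_mul]
      _ ≤ |C| * ‖a‖ := (hC _ (hx i)).trans (by gcongr; exacts [le_abs_self C, hxn i])
  calc p a ≤ ∑ i : Fin 4, p (Complex.I ^ (i : ℕ) • x i) := by
        conv_lhs => rw [hxa]
        exact Finset.le_sum_of_subadditive p (map_zero p).le (map_add_le_add p) _ _
    _ ≤ ∑ _i : Fin 4, |C| * ‖a‖ := Finset.sum_le_sum fun i _ => hpx i
    _ = 4 * |C| * ‖a‖ := by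
        rw [Finset.sum_const, Finset.card_fin, nsmul_eq_mul]; push_cast; ring

end MonotoneSeminorm

section AsymptoticallyBoundedPath

variable {ι V E : Type*} {l : Filter ι} [NeBot l] [SeminormedAddCommGroup E]

theorem limsup_norm_le_iff {f : ι → E} (hf : l.IsBoundedUnder (· ≤ ·) fun t => ‖f t‖) {r : ℝ} :
    limsup (fun t => ‖f t‖) l ≤ r ↔ ∀ s > r, ∀ᶠ t in l, ‖f t‖ < s :=
  limsup_le_iff (isCoboundedUnder_le_of_le l fun t => norm_nonneg (f t)) hf

theorem limsup_norm_le_add {f f₁ f₂ : ι → E} (hf : l.IsBoundedUnder (· ≤ ·) fun t => ‖f t‖)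
    (hf₁ : l.IsBoundedUnder (· ≤ ·) fun t => ‖f₁ t‖)
    (hf₂ : l.IsBoundedUnder (· ≤ ·) fun t => ‖f₂ t‖)
    (h : Tendsto (fun t => f t - (f₁ t + f₂ t)) l (𝓝 0)) :
    limsup (fun t => ‖f t‖) l ≤ limsup (fun t => ‖f₁ t‖) l + limsup (fun t => ‖f₂ t‖) l := by
  refine (limsup_norm_le_iff hf).mpr fun s hs => ?_
  obtain ⟨δ, hδ, hδs⟩ := exists_pos_mul_lt (sub_pos.mpr hs) 3
  filter_upwards [eventually_lt_of_limsup_lt (lt_add_of_pos_right _ hδ) hf₁,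
    eventually_lt_of_limsup_lt (lt_add_of_pos_right _ hδ) hf₂,
    h.norm.eventually_lt_const (u := δ) (by simpa)] with t h₁ h₂ ht
  linarith [norm_le_insert' (f t) (f₁ t + f₂ t), norm_add_le (f₁ t) (f₂ t)]

variable [NormedSpace ℂ E]

theorem limsup_norm_le_mul {f f₁ : ι → E} (hf : l.IsBoundedUnder (· ≤ ·) fun t => ‖f t‖)
    (hf₁ : l.IsBoundedUnder (· ≤ ·) fun t => ‖f₁ t‖) (c : ℂ)
    (h : Tendsto (fun t => f t - c • f₁ t) l (𝓝 0)) :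
    limsup (fun t => ‖f t‖) l ≤ ‖c‖ * limsup (fun t => ‖f₁ t‖) l := by
  refine (limsup_norm_le_iff hf).mpr fun s hs => ?_
  obtain ⟨δ, hδ, hδs⟩ := exists_pos_mul_lt (sub_pos.mpr hs) (‖c‖ + 1)
  filter_upwards [eventually_lt_of_limsup_lt (lt_add_of_pos_right _ hδ) hf₁,
    h.norm.eventually_lt_const (u := δ) (by simpa)] with t h₁ ht
  have hle := norm_le_insert' (f t) (c • f₁ t)
  rw [norm_smul] at hle
  nlinarith [norm_nonneg c]

variable [AddCommGroup V] [Module ℂ V]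

/-- The seminorm `a ↦ limsup ‖ψ t a‖` of an asymptotically linear, pointwise bounded family. -/
noncomputable def limsupSeminorm (l : Filter ι) [NeBot l] (ψ : ι → V → E)
    (hbdd : ∀ a, l.IsBoundedUnder (· ≤ ·) fun t => ‖ψ t a‖)
    (hadd : ∀ a b, Tendsto (fun t => ψ t (a + b) - (ψ t a + ψ t b)) l (𝓝 0))
    (hsmul : ∀ (c : ℂ) a, Tendsto (fun t => ψ t (c • a) - c • ψ t a) l (𝓝 0)) : Seminorm ℂ V :=
  .ofSMulLE (fun a => limsup (fun t => ‖ψ t a‖) l)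
    (le_antisymm
      (by simpa using limsup_norm_le_mul (hbdd _) (hbdd 0) 0 (hsmul 0 0))
      (le_limsup_of_le (hbdd 0) fun _ h =>
        let ⟨_, ht⟩ := h.exists
        (norm_nonneg _).trans ht))
    (fun a b => limsup_norm_le_add (hbdd _) (hbdd a) (hbdd b) (hadd a b))
    (fun c a => limsup_norm_le_mul (hbdd _) (hbdd a) c (hsmul c a))

end AsymptoticallyBoundedPath

section Amplification

variable {A B ι : Type*} {n : ℕ}

theorem tendsto_cstarMatrix_map_sub [NonUnitalCStarAlgebra B] {l : Filter ι} {f g : ι → A → B}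
    (M : CStarMatrix (Fin n) (Fin n) A) (h : ∀ a, Tendsto (fun t => f t a - g t a) l (𝓝 0)) :
    Tendsto (fun t => M.map (f t) - M.map (g t)) l (𝓝 0) :=
  tendsto_pi_nhds.mpr fun i => tendsto_pi_nhds.mpr fun j => h (M i j)

variable [NonUnitalCStarAlgebra A] [NonUnitalCStarAlgebra B]

theorem isSelfAdjoint_of_map_star {f : A → B} (hf : ∀ a, f (star a) = star (f a)) {a : A}
    (ha : IsSelfAdjoint a) : IsSelfAdjoint (f a) := by
  rw [IsSelfAdjoint, ← hf, ha.star_eq]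

theorem isSelfAdjoint_cstarMatrix_map {f : A → B} (hf : ∀ a, f (star a) = star (f a))
    {M : CStarMatrix (Fin n) (Fin n) A} (hM : IsSelfAdjoint M) : IsSelfAdjoint (M.map f) := by
  ext i j
  rw [CStarMatrix.star_apply, CStarMatrix.map_apply, CStarMatrix.map_apply, ← hf,
    ← CStarMatrix.star_apply, hM.star_eq]

theorem map_negPart (f : A →⋆ₙₐ[ℂ] B) {x : A} (hx : IsSelfAdjoint x) : f x⁻ = (f x)⁻ := by
  rw [CFC.negPart_def, CFC.negPart_def,
    NonUnitalStarAlgHom.map_cfcₙ f _ x (hφ := map_continuous f)]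

/-- The diagonal embedding of `B` into `M_n(B)`. -/
def diagonalHom (B : Type*) [NonUnitalCStarAlgebra B] (n : ℕ) :
    B →⋆ₙₐ[ℂ] CStarMatrix (Fin n) (Fin n) B where
  toFun u := CStarMatrix.ofMatrix (Matrix.diagonal fun _ => u)
  map_smul' c u := Matrix.diagonal_smul c fun _ : Fin n => u
  map_zero' := Matrix.diagonal_zero
  map_add' u v := (Matrix.diagonal_add (fun _ : Fin n => u) fun _ => v).symm
  map_mul' u v := (Matrix.diagonal_mul_diagonal (fun _ : Fin n => u) fun _ => v).symm
  map_star' u := (Matrix.diagonal_conjTranspose fun _ : Fin n => u).symm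

theorem diagonalHom_apply_eq (u : B) (i : Fin n) : diagonalHom B n u i i = u :=
  Matrix.diagonal_apply_eq _ i

variable [PartialOrder B] [StarOrderedRing B]

theorem compress_diagonalHom (u : B) (M : CStarMatrix (Fin n) (Fin n) B) :
    compress (diagonalHom B n u) M = M.map (compress u) := by
  have hl : diagonalHom B n u * M = M.map (u * ·) :=
    Matrix.ext fun i j => Matrix.diagonal_mul _ M i j
  have hr (N : CStarMatrix (Fin n) (Fin n) B) : N * diagonalHom B n u = N.map (· * u) :=
    Matrix.ext fun i j => Matrix.mul_diagonal _ N i j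
  rw [compress, hr, hl]
  rfl

end Amplification

section AsymptoticallyCP

variable {A B : Type*} [NonUnitalCStarAlgebra A] [PartialOrder A] [StarOrderedRing A]
  [NonUnitalCStarAlgebra B] [PartialOrder B] [StarOrderedRing B]
  {ψ : Set.Ici (1 : ℝ) → A → B}

namespace IsAsymptoticallyCP

theorem isSelfAdjoint (hψ : IsAsymptoticallyCP ψ) (t : Set.Ici (1 : ℝ)) {a : A}
    (ha : IsSelfAdjoint a) : IsSelfAdjoint (ψ t a) :=
  isSelfAdjoint_of_map_star (hψ.map_star t) ha

theorem tendsto_norm_negPart (hψ : IsAsymptoticallyCP ψ) {a : A} (ha : 0 ≤ a) :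
    Tendsto (fun t => ‖(ψ t a)⁻‖) atTop (𝓝 0) := by
  have hmap (t) : (diagonalHom A 1 a).map (ψ t) = diagonalHom B 1 (ψ t a) := by
    ext i j
    obtain rfl := Subsingleton.elim i j
    rw [CStarMatrix.map_apply, diagonalHom_apply_eq, diagonalHom_apply_eq]
  have h := hψ.asymptotically_positive 1 (diagonalHom A 1 a) (map_nonneg (diagonalHom A 1) ha)
  refine squeeze_zero (fun _ => norm_nonneg _) (fun t => ?_) h
  rw [cstarNegPart, hmap, ← map_negPart _ (hψ.isSelfAdjoint t ha.isSelfAdjoint)]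
  conv_lhs => rw [← diagonalHom_apply_eq (ψ t a)⁻ (0 : Fin 1)]
  exact CStarMatrix.norm_entry_le_norm

theorem tendsto_add (hψ : IsAsymptoticallyCP ψ) (a b : A) :
    Tendsto (fun t => ψ t (a + b) - (ψ t a + ψ t b)) atTop (𝓝 0) := by
  simpa only [one_smul, sub_sub] using
    tendsto_zero_iff_norm_tendsto_zero.mpr (hψ.asymptotically_linear 1 1 a b)

theorem tendsto_smul (hψ : IsAsymptoticallyCP ψ) (c : ℂ) (a : A) :
    Tendsto (fun t => ψ t (c • a) - c • ψ t a) atTop (𝓝 0) := by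
  simpa only [zero_smul, add_zero, sub_zero] using
    tendsto_zero_iff_norm_tendsto_zero.mpr (hψ.asymptotically_linear c 0 a 0)

theorem tendsto_sub (hψ : IsAsymptoticallyCP ψ) (a b : A) :
    Tendsto (fun t => ψ t (a - b) - (ψ t a - ψ t b)) atTop (𝓝 0) := by
  simpa only [one_smul, neg_smul, ← sub_eq_add_neg, sub_neg_eq_add, ← sub_add] using
    tendsto_zero_iff_norm_tendsto_zero.mpr (hψ.asymptotically_linear 1 (-1) a b)

theorem isBoundedUnder_norm (hψ : IsAsymptoticallyCP ψ) (a : A) :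
    atTop.IsBoundedUnder (· ≤ ·) fun t => ‖ψ t a‖ :=
  let ⟨C, hC⟩ := hψ.bounded a
  isBoundedUnder_of ⟨C, hC⟩

theorem limsup_norm_mono (hψ : IsAsymptoticallyCP ψ) {a b : A} (ha : 0 ≤ a) (hab : a ≤ b) :
    limsup (fun t => ‖ψ t a‖) atTop ≤ limsup (fun t => ‖ψ t b‖) atTop := by
  have hba := sub_nonneg.mpr hab
  refine (limsup_norm_le_iff (hψ.isBoundedUnder_norm a)).mpr fun s hs => ?_
  obtain ⟨δ, hδ, hδs⟩ := exists_pos_mul_lt (sub_pos.mpr hs) 5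
  have hadd := hψ.tendsto_add a (b - a)
  rw [add_sub_cancel] at hadd
  filter_upwards [eventually_lt_of_limsup_lt (lt_add_of_pos_right _ hδ) (hψ.isBoundedUnder_norm b),
    (hψ.tendsto_norm_negPart ha).eventually_lt_const hδ,
    (hψ.tendsto_norm_negPart hba).eventually_lt_const hδ,
    hadd.norm.eventually_lt_const (u := δ) (by simpa)] with t hb hna hnba hsub
  have hle := norm_le_norm_add_add_norm_negPart (hψ.isSelfAdjoint t ha.isSelfAdjoint)
    (hψ.isSelfAdjoint t hba.isSelfAdjoint)
  linarith [norm_le_insert (ψ t b) (ψ t a + ψ t (b - a))]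

theorem exists_eventually_norm_sub_le (hψ : IsAsymptoticallyCP ψ) :
    ∃ C > 0, ∀ a b : A, ∀ᶠ t in atTop, ‖ψ t a - ψ t b‖ ≤ C * ‖a - b‖ := by
  obtain ⟨C, hC⟩ := exists_le_mul_norm_of_monotone
    (limsupSeminorm atTop ψ hψ.isBoundedUnder_norm hψ.tendsto_add hψ.tendsto_smul)
    fun _ _ => hψ.limsup_norm_mono
  refine ⟨|C| + 2, by positivity, fun a b => ?_⟩
  rcases eq_or_ne a b with rfl | hab
  · exact .of_forall fun t => by simp only [sub_self, norm_zero, mul_zero, le_refl]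
  have hpos : 0 < ‖a - b‖ := norm_pos_iff.mpr (sub_ne_zero.mpr hab)
  have hlimsup : limsup (fun t => ‖ψ t (a - b)‖) atTop < (|C| + 1) * ‖a - b‖ :=
    (hC (a - b)).trans_lt <|
      mul_lt_mul_of_pos_right (lt_add_of_le_of_pos (le_abs_self C) one_pos) hpos
  filter_upwards [eventually_lt_of_limsup_lt hlimsup (hψ.isBoundedUnder_norm _),
    (hψ.tendsto_sub a b).norm.eventually_lt_const (by rwa [norm_zero])] with t hC' hsub
  linarith [norm_le_insert (ψ t (a - b)) (ψ t a - ψ t b)]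

end IsAsymptoticallyCP

end AsymptoticallyCP

section AttainsQuotientNorm

variable {ι B Q : Type*} [NonUnitalCStarAlgebra B] [NonUnitalCStarAlgebra Q] {π : B →⋆ₙₐ[ℂ] Q}
  {l : Filter ι} {x : ι → B}

/-- The norm of `x` is asymptotically the norm of its image in the quotient. -/
def AttainsQuotientNorm (π : B →⋆ₙₐ[ℂ] Q) (l : Filter ι) (x : ι → B) : Prop :=
  Tendsto (fun i => ‖x i‖ - ‖π (x i)‖) l (𝓝 0)

theorem attainsQuotientNorm_iff :
    AttainsQuotientNorm π l x ↔ ∀ ε > 0, ∀ᶠ i in l, ‖x i‖ ≤ ‖π (x i)‖ + ε := by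
  refine Metric.nhds_basis_closedBall.tendsto_right_iff.trans
    (forall₂_congr fun ε _ => eventually_congr (.of_forall fun i => ?_))
  have hle := NonUnitalStarAlgHom.norm_apply_le π (x i)
  rw [mem_closedBall_zero_iff, Real.norm_of_nonneg (sub_nonneg.mpr hle), sub_le_iff_le_add']

theorem AttainsQuotientNorm.tendsto_norm {q : Q} (h : AttainsQuotientNorm π l x)
    (hx : ∀ i, π (x i) = q) : Tendsto (fun i => ‖x i‖) l (𝓝 ‖q‖) := by
  simpa only [hx, sub_add_cancel, zero_add] using Tendsto.add_const ‖q‖ h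

theorem AttainsQuotientNorm.of_forall_exists_norm_sub_le
    (h : ∀ ε > 0, ∃ y, AttainsQuotientNorm π l y ∧ ∀ᶠ i in l, ‖x i - y i‖ ≤ ε) :
    AttainsQuotientNorm π l x := by
  refine attainsQuotientNorm_iff.mpr fun ε hε => ?_
  obtain ⟨y, hy, hxy⟩ := h (ε / 3) (by positivity)
  filter_upwards [attainsQuotientNorm_iff.mp hy (ε / 3) (by positivity), hxy] with i hyi hxyi
  have hπ : ‖π (x i) - π (y i)‖ ≤ ε / 3 := by
    rw [← map_sub]
    exact (NonUnitalStarAlgHom.norm_apply_le π _).trans hxyi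
  linarith [norm_le_insert' (x i) (y i), norm_le_insert (π (x i)) (π (y i))]

theorem AttainsQuotientNorm.of_tendsto_sub {y : ι → B} (hy : AttainsQuotientNorm π l y)
    (h : Tendsto (fun i => x i - y i) l (𝓝 0)) : AttainsQuotientNorm π l x :=
  .of_forall_exists_norm_sub_le fun _ hε =>
    ⟨y, hy, (h.norm.eventually_lt_const (by rwa [norm_zero])).mono fun _ => le_of_lt⟩

end AttainsQuotientNorm

section CompressPath

variable {G A B Q : Type*} [Group G] [NonUnitalCStarAlgebra B]
  [NonUnitalCStarAlgebra Q]

/-- The compression of the path `ψ` by `1 - u`. -/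
def compressPath (u : Set.Ici (1 : ℝ) → B) (ψ : Set.Ici (1 : ℝ) → A → B) (t : Set.Ici (1 : ℝ))
    (a : A) : B :=
  compress (u t) (ψ t a)

/-- The paths along which a quasicentral path is chosen: the values of `ψ` on `D`, their products,
and their defects of equivariance. -/
def testPaths (β : G →* (B ≃⋆ₐ[ℂ] B)) (ψ : Set.Ici (1 : ℝ) → A → B) (D : Set A) :
    Set (Set.Ici (1 : ℝ) × G → B) :=
  (fun a p => ψ p.1 a) '' D ∪ (Set.image2 (fun a b p => ψ p.1 a * ψ p.1 b) D D ∪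
    Set.image2 (fun a b p => β p.2 (ψ p.1 a) - ψ p.1 b) D D)

theorem countable_testPaths (β : G →* (B ≃⋆ₐ[ℂ] B)) (ψ : Set.Ici (1 : ℝ) → A → B) {D : Set A}
    (hD : D.Countable) : (testPaths β ψ D).Countable :=
  (hD.image _).union ((hD.image2 hD _).union (hD.image2 hD _))

variable [TopologicalSpace G]

theorem continuous_of_mem_testPaths {β : G →* (B ≃⋆ₐ[ℂ] B)} (hβ : IsContinuousAction β)
    {ψ : Set.Ici (1 : ℝ) → A → B} (hψ : ∀ a, Continuous fun t => ψ t a) (D : Set A) :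
    ∀ f ∈ testPaths β ψ D, Continuous f := by
  have hψ' (a : A) : Continuous fun p : Set.Ici (1 : ℝ) × G => ψ p.1 a :=
    (hψ a).comp continuous_fst
  rintro _ (⟨a, -, rfl⟩ | ⟨a, -, b, -, rfl⟩ | ⟨a, -, b, -, rfl⟩)
  · exact hψ' a
  · exact (hψ' a).mul (hψ' b)
  · exact (hβ.continuous_uncurry.comp (continuous_snd.prodMk (hψ' a))).sub (hψ' b)

theorem IsLiftPath.compressPath {π : B →⋆ₙₐ[ℂ] Q} {φ : A → Q} {ψ : Set.Ici (1 : ℝ) → A → B}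
    (hψ : IsLiftPath π φ ψ) {u : Set.Ici (1 : ℝ) → B} (hu : ∀ t, π (u t) = 0) :
    IsLiftPath π φ (compressPath u ψ) := fun t a => by
  rw [_root_.compressPath, map_compress, hu, compress_zero_left, hψ]

namespace IsQuasicentralPath

variable [PartialOrder B] {β : G →* (B ≃⋆ₐ[ℂ] B)} {π : B →⋆ₙₐ[ℂ] Q}
  {F : Set (Set.Ici (1 : ℝ) × G → B)} {u : Set.Ici (1 : ℝ) → B}
  {f : Set.Ici (1 : ℝ) × G → B}

theorem tendsto_displacement (hu : IsQuasicentralPath β π F u) (hF : F.Nonempty) (g : G) :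
    Tendsto (fun p : Set.Ici (1 : ℝ) × G => β p.2 (u p.1) - u p.1) (atTop ×ˢ 𝓝 g) (𝓝 0) := by
  obtain ⟨f, hf⟩ := hF
  refine Metric.nhds_basis_closedBall.tendsto_right_iff.mpr fun ε hε => ?_
  filter_upwards [hu.eventually_mem_quasicentralSet f hf g ε hε] with p hp
  exact mem_closedBall_zero_iff.mpr (hp.2.2 _ (.inl ⟨p.2, rfl, rfl⟩))

theorem tendsto_commutator (hu : IsQuasicentralPath β π F u) (hf : f ∈ F) (g : G) :
    Tendsto (fun p => u p.1 * f p - f p * u p.1) (atTop ×ˢ 𝓝 g) (𝓝 0) := by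
  refine Metric.nhds_basis_closedBall.tendsto_right_iff.mpr fun ε hε => ?_
  filter_upwards [hu.eventually_mem_quasicentralSet f hf g ε hε] with p hp
  exact mem_closedBall_zero_iff.mpr (hp.2.2 _ (.inr ⟨f p, rfl, rfl⟩))

theorem eventually_norm_sub_mul_le (hu : IsQuasicentralPath β π F u) (hf : f ∈ F) (g : G) {ε : ℝ}
    (hε : 0 < ε) : ∀ᶠ p in atTop ×ˢ 𝓝 g, ‖f p - f p * u p.1‖ ≤ ‖π (f p)‖ + ε :=
  (hu.eventually_mem_quasicentralSet f hf g ε hε).mono fun _ hp => hp.2.1 _ rfl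

variable [StarOrderedRing B]

theorem attainsQuotientNorm_compress (hu : IsQuasicentralPath β π F u) (hf : f ∈ F) (g : G) :
    AttainsQuotientNorm π (atTop ×ˢ 𝓝 g) fun p => compress (u p.1) (f p) := by
  refine attainsQuotientNorm_iff.mpr fun ε hε => ?_
  filter_upwards [hu.eventually_norm_sub_mul_le hf g hε] with p hp
  obtain ⟨hu0, hu1, huπ⟩ := hu.mem_idealContractions p.1
  rw [map_compress, huπ, compress_zero_left]
  exact (norm_compress_le_sub hu0 hu1 _).trans hp

variable {ψ : Set.Ici (1 : ℝ) → A → B} {D : Set A} {a b : A}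

theorem attainsQuotientNorm_compressPath (hu : IsQuasicentralPath β π (testPaths β ψ D) u)
    (ha : a ∈ D) : AttainsQuotientNorm π atTop fun t => compressPath u ψ t a :=
  (hu.attainsQuotientNorm_compress (f := fun p => ψ p.1 a) (.inl ⟨a, ha, rfl⟩) 1).comp
    (tendsto_id.prodMk tendsto_const_nhds)

theorem attainsQuotientNorm_mul (hu : IsQuasicentralPath β π (testPaths β ψ D) u)
    (ha : a ∈ D) (hb : b ∈ D) {C : ℝ} (hC : ∀ t, ‖ψ t a‖ ≤ C) :
    AttainsQuotientNorm π atTop fun t => compressPath u ψ t a * compressPath u ψ t b := by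
  have hpair : Tendsto (fun t : Set.Ici (1 : ℝ) => (t, (1 : G))) atTop (atTop ×ˢ 𝓝 1) :=
    tendsto_id.prodMk tendsto_const_nhds
  refine attainsQuotientNorm_iff.mpr fun ε hε => ?_
  obtain ⟨δ, hδ, hδε⟩ := exists_pos_mul_lt (half_pos hε) (2 * C)
  have hunit := hu.eventually_norm_sub_mul_le
    (f := fun p => ψ p.1 a * ψ p.1 b) (.inr (.inl ⟨a, ha, b, hb, rfl⟩)) 1 (half_pos hε)
  have hcomm := hu.tendsto_commutator (f := fun p => ψ p.1 b) (.inl ⟨b, hb, rfl⟩) 1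
  filter_upwards [hpair.eventually hunit,
    hpair.eventually (hcomm.norm.eventually_lt_const (u := δ) (by rwa [norm_zero]))] with t ht hδt
  obtain ⟨hu0, hu1, huπ⟩ := hu.mem_idealContractions t
  have hle := norm_compress_mul_compress_le hu0 hu1 (ψ t a) (ψ t b)
  have hsmall : 2 * ‖ψ t a‖ * ‖u t * ψ t b - ψ t b * u t‖ ≤ 2 * C * δ := by
    have hC0 : 0 ≤ C := (norm_nonneg _).trans (hC t)
    gcongr
    exact hC t
  simp only [compressPath, map_mul, map_compress, huπ, compress_zero_left] at ht hle ⊢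
  linarith

theorem attainsQuotientNorm_apply_sub (hu : IsQuasicentralPath β π (testPaths β ψ D) u)
    (ha : a ∈ D) (hb : b ∈ D) {C : ℝ} (hC : ∀ t, ‖ψ t a‖ ≤ C) (g : G) :
    AttainsQuotientNorm π (atTop ×ˢ 𝓝 g) fun p : Set.Ici (1 : ℝ) × G =>
      β p.2 (compressPath u ψ p.1 a) - compressPath u ψ p.1 b := by
  refine (hu.attainsQuotientNorm_compress (f := fun p => β p.2 (ψ p.1 a) - ψ p.1 b)
    (.inr (.inr ⟨a, ha, b, hb, rfl⟩)) g).of_tendsto_sub ?_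
  have hdisp := (hu.tendsto_displacement ⟨_, .inl ⟨a, ha, rfl⟩⟩ g).norm.const_mul 2 |>.mul_const C
  rw [norm_zero, mul_zero, zero_mul] at hdisp
  refine squeeze_zero_norm (fun p => ?_) hdisp
  obtain ⟨hu0, hu1, -⟩ := hu.mem_idealContractions p.1
  have hle := norm_compress_sub_compress_le (map_nonneg (β p.2) hu0)
    ((StarAlgEquiv.norm_map (β p.2) _).trans_le hu1) hu0 hu1 (β p.2 (ψ p.1 a))
  calc _ = ‖compress (β p.2 (u p.1)) (β p.2 (ψ p.1 a)) - compress (u p.1) (β p.2 (ψ p.1 a))‖ := by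
        rw [compressPath, compressPath, map_compress, compress_sub, sub_sub_sub_cancel_right]
    _ ≤ 2 * ‖β p.2 (u p.1) - u p.1‖ * C := by
        refine hle.trans ?_
        rw [StarAlgEquiv.norm_map]
        gcongr
        exact hC _

end IsQuasicentralPath

variable [NonUnitalCStarAlgebra A] [PartialOrder A] [StarOrderedRing A] [PartialOrder B]
  [StarOrderedRing B] {ψ : Set.Ici (1 : ℝ) → A → B}

theorem IsAsymptoticallyCP.compressPath (hψ : IsAsymptoticallyCP ψ) {u : Set.Ici (1 : ℝ) → B}
    (huc : Continuous u) (hu0 : ∀ t, 0 ≤ u t) (hu1 : ∀ t, ‖u t‖ ≤ 1) :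
    IsAsymptoticallyCP (compressPath u ψ) where
  continuous_path a := by
    have hψa := hψ.continuous_path a
    simp only [_root_.compressPath, compress]
    fun_prop
  bounded a := (hψ.bounded a).imp fun _ hC t => (norm_compress_le (hu0 t) (hu1 t) _).trans (hC t)
  map_star t a := by
    rw [_root_.compressPath, _root_.compressPath, hψ.map_star, star_compress (hu0 t).isSelfAdjoint]
  asymptotically_linear μ ν a b := by
    refine squeeze_zero (fun _ => norm_nonneg _) (fun t => ?_) (hψ.asymptotically_linear μ ν a b)
    simp only [_root_.compressPath, ← compress_smul, ← compress_sub]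
    exact norm_compress_le (hu0 t) (hu1 t) _
  asymptotically_positive n M hM := by
    refine squeeze_zero (fun _ => norm_nonneg _) (fun t => ?_) (hψ.asymptotically_positive n M hM)
    have hmap : M.map (_root_.compressPath u ψ t)
        = compress (diagonalHom B n (u t)) (M.map (ψ t)) := (compress_diagonalHom _ _).symm
    rw [cstarNegPart, hmap]
    exact norm_negPart_compress_le (map_nonneg (diagonalHom B n) (hu0 t))
      ((NonUnitalStarAlgHom.norm_apply_le (diagonalHom B n) (u t)).trans (hu1 t))
      (isSelfAdjoint_cstarMatrix_map (hψ.map_star t) hM.isSelfAdjoint)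

end CompressPath

section LocallyAsymptotic

variable {A B : Type*} [NonUnitalCStarAlgebra A] [NonUnitalCStarAlgebra B]

/-- The path `ψ` is asymptotic to `χ`, locally uniformly in the argument: `χ` itself need not be
continuous in its argument. -/
def IsLocallyAsymptotic (ψ χ : Set.Ici (1 : ℝ) → A → B) : Prop :=
  ∀ a, Tendsto (fun p : Set.Ici (1 : ℝ) × A => ψ p.1 p.2 - χ p.1 a) (atTop ×ˢ 𝓝 a) (𝓝 0)

namespace IsLocallyAsymptotic

variable {ψ χ : Set.Ici (1 : ℝ) → A → B}

theorem tendsto (h : IsLocallyAsymptotic ψ χ) (a : A) :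
    Tendsto (fun t => ψ t a - χ t a) atTop (𝓝 0) :=
  (h a).comp (tendsto_id.prodMk tendsto_const_nhds)

theorem of_tendsto_sub {ψ' : Set.Ici (1 : ℝ) → A → B} (h : IsLocallyAsymptotic ψ χ)
    (hsub : ∀ a, Tendsto (fun p : Set.Ici (1 : ℝ) × A => ψ' p.1 p.2 - ψ p.1 p.2) (atTop ×ˢ 𝓝 a)
      (𝓝 0)) : IsLocallyAsymptotic ψ' χ := fun a => by
  simpa only [sub_add_sub_cancel, add_zero] using (hsub a).add (h a)

variable {C : ℝ} (hC : 0 < C) (hχ : ∀ a b, ∀ᶠ t in atTop, ‖χ t a - χ t b‖ ≤ C * ‖a - b‖)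
  {D : Set A} (hD : Dense D)

include hC hχ hD

theorem exists_eventually_norm_sub_le (h : IsLocallyAsymptotic ψ χ) (a : A) {ε : ℝ} (hε : 0 < ε) :
    ∃ d ∈ D, ∀ᶠ p in atTop ×ˢ 𝓝 a, ‖ψ p.1 p.2 - χ p.1 d‖ ≤ ε := by
  obtain ⟨d, hdD, hd⟩ := hD.exists_dist_lt a (show 0 < ε / 2 / C by positivity)
  refine ⟨d, hdD, ?_⟩
  filter_upwards [(h a).norm.eventually_lt_const (u := ε / 2) (by rw [norm_zero]; positivity),
    (hχ a d).prod_inl (𝓝 a)] with p hp hpd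
  have had : C * ‖a - d‖ ≤ ε / 2 := by
    rw [dist_eq_norm, lt_div_iff₀' hC] at hd
    exact hd.le
  linarith [norm_sub_le_norm_sub_add_norm_sub (ψ p.1 p.2) (χ p.1 a) (χ p.1 d)]

variable {Q : Type*} [NonUnitalCStarAlgebra Q] {π : B →⋆ₙₐ[ℂ] Q}

theorem attainsQuotientNorm (h : IsLocallyAsymptotic ψ χ)
    (hD' : ∀ a ∈ D, AttainsQuotientNorm π atTop fun t => χ t a) (a : A) :
    AttainsQuotientNorm π (atTop ×ˢ 𝓝 a) fun p => ψ p.1 p.2 := by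
  refine .of_forall_exists_norm_sub_le fun ε hε => ?_
  obtain ⟨d, hdD, hd⟩ := h.exists_eventually_norm_sub_le hC hχ hD a hε
  exact ⟨_, (hD' d hdD).comp tendsto_fst, hd⟩

theorem attainsQuotientNorm_mul (h : IsLocallyAsymptotic ψ χ) (hψ : IsContractivePath ψ)
    (hmul : ∀ a ∈ D, ∀ b ∈ D, AttainsQuotientNorm π atTop fun t => χ t a * χ t b) (a b : A) :
    AttainsQuotientNorm π atTop fun t => ψ t a * ψ t b := by
  refine .of_forall_exists_norm_sub_le fun ε hε => ?_
  have hpair (a : A) : Tendsto (fun t : Set.Ici (1 : ℝ) => (t, a)) atTop (atTop ×ˢ 𝓝 a) :=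
    tendsto_id.prodMk tendsto_const_nhds
  obtain ⟨δ, hδ, hδε⟩ := exists_pos_mul_lt hε (‖a‖ + ‖b‖ + 1)
  obtain ⟨d, hdD, hd⟩ :=
    h.exists_eventually_norm_sub_le hC hχ hD a (lt_min hδ one_pos)
  obtain ⟨e, heD, he⟩ := h.exists_eventually_norm_sub_le hC hχ hD b hδ
  refine ⟨_, hmul d hdD e heD, ?_⟩
  filter_upwards [(hpair a).eventually hd, (hpair b).eventually he] with t htd hte
  have hχd : ‖χ t d‖ ≤ ‖a‖ + 1 := by
    linarith [norm_le_insert (ψ t a) (χ t d), hψ t a, htd.trans (min_le_right _ _)]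
  calc ‖ψ t a * ψ t b - χ t d * χ t e‖
      = ‖(ψ t a - χ t d) * ψ t b + χ t d * (ψ t b - χ t e)‖ := by congr 1; noncomm_ring
    _ ≤ δ * ‖b‖ + (‖a‖ + 1) * δ := by
        refine norm_add_le_of_le (norm_mul_le_of_le ?_ (hψ t b)) (norm_mul_le_of_le hχd hte)
        exact htd.trans (min_le_left _ _)
    _ = (‖a‖ + ‖b‖ + 1) * δ := by ring
    _ ≤ ε := hδε.le

theorem attainsQuotientNorm_apply_sub {G : Type*} [Group G] [TopologicalSpace G]
    {β : G →* (B ≃⋆ₐ[ℂ] B)} (h : IsLocallyAsymptotic ψ χ)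
    (hsub : ∀ a ∈ D, ∀ b ∈ D, ∀ g, AttainsQuotientNorm π (atTop ×ˢ 𝓝 g)
      fun p : Set.Ici (1 : ℝ) × G => β p.2 (χ p.1 a) - χ p.1 b) (a b : A) (g : G) :
    AttainsQuotientNorm π (atTop ×ˢ 𝓝 (g, b))
      fun p : Set.Ici (1 : ℝ) × G × A => β p.2.1 (ψ p.1 a) - ψ p.1 p.2.2 := by
  refine .of_forall_exists_norm_sub_le fun ε hε => ?_
  obtain ⟨d, hdD, hd⟩ := h.exists_eventually_norm_sub_le hC hχ hD a (half_pos hε)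
  obtain ⟨e, heD, he⟩ := h.exists_eventually_norm_sub_le hC hχ hD b (half_pos hε)
  have hfst : Tendsto (fun p : Set.Ici (1 : ℝ) × G × A => (p.1, p.2.1)) (atTop ×ˢ 𝓝 (g, b))
      (atTop ×ˢ 𝓝 g) := tendsto_id.prodMap (continuous_fst.tendsto (g, b))
  have hsnd : Tendsto (fun p : Set.Ici (1 : ℝ) × G × A => (p.1, p.2.2)) (atTop ×ˢ 𝓝 (g, b))
      (atTop ×ˢ 𝓝 b) := tendsto_id.prodMap (continuous_snd.tendsto (g, b))
  have hconst : Tendsto (fun p : Set.Ici (1 : ℝ) × G × A => (p.1, a)) (atTop ×ˢ 𝓝 (g, b))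
      (atTop ×ˢ 𝓝 a) := tendsto_fst.prodMk tendsto_const_nhds
  refine ⟨_, (hsub d hdD e heD g).comp hfst, ?_⟩
  filter_upwards [hconst.eventually hd, hsnd.eventually he] with p hpd hpe
  calc ‖β p.2.1 (ψ p.1 a) - ψ p.1 p.2.2 - (β p.2.1 (χ p.1 d) - χ p.1 e)‖
      = ‖β p.2.1 (ψ p.1 a - χ p.1 d) - (ψ p.1 p.2.2 - χ p.1 e)‖ := by
        rw [map_sub, sub_sub_sub_comm]
    _ ≤ ε / 2 + ε / 2 :=
        norm_sub_le_of_le ((StarAlgEquiv.norm_map (β p.2.1) _).trans_le hpd) hpe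
    _ = ε := add_halves ε

end IsLocallyAsymptotic

end LocallyAsymptotic

section Selection

variable {A B Q : Type*} [NonUnitalCStarAlgebra A] [NonUnitalCStarAlgebra B]
  {χ : Set.Ici (1 : ℝ) → A → B} {C : ℝ}

theorem exists_forall_norm_sub_le_of_eventually
    (hχ : ∀ a b, ∀ᶠ t in atTop, ‖χ t a - χ t b‖ ≤ C * ‖a - b‖) (d : ℕ → A) :
    ∃ τ : ℕ → ℝ, (∀ i : ℕ, i ≤ τ i) ∧ ∀ i j (t : Set.Ici (1 : ℝ)), τ i ≤ t → τ j ≤ t →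
      ‖χ t (d i) - χ t (d j)‖ ≤ C * ‖d i - d j‖ := by
  have hlip (k : ℕ) : ∃ s : Set.Ici (1 : ℝ), ∀ t ≥ s, ∀ i ∈ Set.Iic k,
      ‖χ t (d i) - χ t (d k)‖ ≤ C * ‖d i - d k‖ :=
    eventually_atTop.mp ((Set.finite_Iic k).eventually_all.mpr fun i _ => hχ (d i) (d k))
  choose s hs using hlip
  refine ⟨fun k => max k (s k), fun k => le_max_left _ _, fun i j t hi hj => ?_⟩
  rcases le_total i j with hij | hji
  · exact hs j t (le_of_max_le_right (a := (j : ℝ)) hj) i hij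
  · rw [norm_sub_rev, norm_sub_rev (d i)]
    exact hs i t (le_of_max_le_right (a := (i : ℝ)) hi) j hji

variable [NonUnitalCStarAlgebra Q] {π : B →⋆ₙₐ[ℂ] Q} {φ : A → Q}

theorem IsLiftPath.norm_sub_le (hlift : IsLiftPath π φ χ)
    (hχ : ∀ a b, ∀ᶠ t in atTop, ‖χ t a - χ t b‖ ≤ C * ‖a - b‖) (a b : A) :
    ‖φ a - φ b‖ ≤ C * ‖a - b‖ := by
  obtain ⟨t, ht⟩ := (hχ a b).exists
  rw [← hlift t, ← hlift t, ← map_sub]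
  exact (NonUnitalStarAlgHom.norm_apply_le π _).trans ht

variable [PartialOrder B] [StarOrderedRing B] [PartialOrder Q] [StarOrderedRing Q]

theorem exists_continuousMap_norm_sub_le (hχc : ∀ a, Continuous fun t => χ t a)
    (hlift : IsLiftPath π φ χ) (hφ : ∀ a b, ‖φ a - φ b‖ ≤ C * ‖a - b‖) {d : ℕ → A} {τ : ℕ → ℝ}
    (hτ : ∀ i : ℕ, i ≤ τ i)
    (hτχ : ∀ i j (t : Set.Ici (1 : ℝ)), τ i ≤ t → τ j ≤ t →
      ‖χ t (d i) - χ t (d j)‖ ≤ C * ‖d i - d j‖) (hC : 0 ≤ C) (a : A) :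
    ∃ f : C(Set.Ici (1 : ℝ), B), ∀ t, π (f t) = φ a ∧
      ∀ i, τ i + 1 ≤ t → ‖f t - χ t (d i)‖ ≤ 3 * C * ‖a - d i‖ := by
  refine exists_continuous_forall_mem_convex_of_local
    (t := fun t : Set.Ici (1 : ℝ) =>
      {b | π b = φ a ∧ ∀ i, τ i + 1 ≤ t → ‖b - χ t (d i)‖ ≤ 3 * C * ‖a - d i‖})
    (fun t => ?_) fun t₀ => ?_
  · simp only [Set.ofPred_and, Set.ofPred_forall]
    refine (convex_setOf_map_eq π (φ a)).inter (convex_iInter₂ fun i _ => ?_)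
    simpa only [Metric.closedBall, dist_eq_norm] using
      convex_closedBall (χ t (d i)) (3 * C * ‖a - d i‖)
  have hfin : {i | τ i ≤ t₀ - 1 / 2}.Finite :=
    (Set.finite_Iic ⌊(t₀ : ℝ)⌋₊).subset fun i hi => Nat.le_floor (by linarith [hτ i, hi.out])
  have hactive {t : Set.Ici (1 : ℝ)} (ht : t ∈ Metric.ball t₀ (1 / 2)) {i : ℕ}
      (hi : τ i + 1 ≤ t) : τ i ≤ t₀ - 1 / 2 := by
    linarith [(abs_lt.mp (show |(t : ℝ) - t₀| < 1 / 2 from ht)).2]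
  have hlip {t : Set.Ici (1 : ℝ)} (ht : t ∈ Metric.ball t₀ (1 / 2)) {i : ℕ}
      (hi : τ i ≤ t₀ - 1 / 2) : τ i ≤ t := by
    linarith [(abs_lt.mp (show |(t : ℝ) - t₀| < 1 / 2 from ht)).1]
  refine ⟨Metric.ball t₀ (1 / 2), Metric.ball_mem_nhds _ one_half_pos, ?_⟩
  rcases Set.eq_empty_or_nonempty {i | τ i ≤ t₀ - 1 / 2} with hempty | hne
  · refine ⟨fun t => χ t a, (hχc a).continuousOn, fun t ht => ⟨hlift t a, fun i hi => ?_⟩⟩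
    exact absurd (hactive ht hi) (Set.eq_empty_iff_forall_notMem.mp hempty i)
  obtain ⟨k, hk, hkmin⟩ := Set.exists_min_image _ (fun i => ‖a - d i‖) hfin hne
  obtain ⟨r, hr, hrC⟩ := exists_map_eq_norm_le π (χ t₀ a - χ t₀ (d k))
  rw [map_sub, hlift, hlift] at hr hrC
  refine ⟨fun t => χ t (d k) + r, ((hχc _).add continuous_const).continuousOn,
    fun t ht => ⟨by rw [map_add, hlift, hr, add_sub_cancel], fun i hi => ?_⟩⟩
  have hki := hkmin i (hactive ht hi)
  calc ‖χ t (d k) + r - χ t (d i)‖ = ‖(χ t (d k) - χ t (d i)) + r‖ := by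
        rw [add_sub_right_comm]
    _ ≤ C * ‖d k - d i‖ + C * ‖a - d k‖ :=
        norm_add_le_of_le (hτχ k i t (hlip ht hk) (hlip ht (hactive ht hi)))
          (hrC.trans (hφ _ _))
    _ ≤ C * (‖a - d i‖ + ‖a - d i‖) + C * ‖a - d i‖ := by
        gcongr
        rw [norm_sub_rev (d k)]
        refine (norm_sub_le_norm_sub_add_norm_sub _ a _).trans ?_
        rw [norm_sub_rev (d i)]
        gcongr
    _ = 3 * C * ‖a - d i‖ := by ring

theorem exists_isLocallyAsymptotic [TopologicalSpace.SeparableSpace A]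
    (hχc : ∀ a, Continuous fun t => χ t a) (hlift : IsLiftPath π φ χ) (hC : 0 < C)
    (hχ : ∀ a b, ∀ᶠ t in atTop, ‖χ t a - χ t b‖ ≤ C * ‖a - b‖) :
    ∃ ψ : Set.Ici (1 : ℝ) → A → B, (∀ a, Continuous fun t => ψ t a) ∧ IsLiftPath π φ ψ ∧
      IsLocallyAsymptotic ψ χ := by
  let d := TopologicalSpace.denseSeq A
  obtain ⟨τ, hτ, hτχ⟩ := exists_forall_norm_sub_le_of_eventually hχ d
  choose ψ hψ using exists_continuousMap_norm_sub_le hχc hlift (hlift.norm_sub_le hχ) hτ hτχ hC.le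
  refine ⟨fun t a => ψ a t, fun a => (ψ a).continuous, fun t a => (hψ a t).1, fun a => ?_⟩
  refine Metric.nhds_basis_closedBall.tendsto_right_iff.mpr fun ε hε => ?_
  obtain ⟨δ, hδ, hδε⟩ := exists_pos_mul_lt hε (7 * C)
  obtain ⟨j, hj⟩ := (TopologicalSpace.denseRange_denseSeq A).exists_dist_lt a hδ
  have hlate : ∀ᶠ t : Set.Ici (1 : ℝ) in atTop, τ j + 1 ≤ t :=
    tendsto_Ici_atTop.mp tendsto_id |>.eventually_ge_atTop _
  have hnear : ∀ᶠ b in 𝓝 a, b ∈ Metric.ball a δ := Metric.ball_mem_nhds a hδ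
  filter_upwards [(hlate.and (hχ (d j) a)).prod_inl (𝓝 a),
    hnear.prod_inr atTop] with p ⟨ht, hja⟩ hp
  rw [dist_eq_norm] at hj
  rw [mem_ball_iff_norm] at hp
  have hpj : ‖p.2 - d j‖ ≤ δ + δ :=
    (norm_sub_le_norm_sub_add_norm_sub _ a _).trans (add_le_add hp.le hj.le)
  rw [mem_closedBall_zero_iff]
  calc ‖ψ p.2 p.1 - χ p.1 a‖
      ≤ ‖ψ p.2 p.1 - χ p.1 (d j)‖ + ‖χ p.1 (d j) - χ p.1 a‖ :=
        norm_sub_le_norm_sub_add_norm_sub _ _ _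
    _ ≤ 3 * C * (δ + δ) + C * δ := by
        rw [norm_sub_rev (d j)] at hja
        exact add_le_add (((hψ p.2 p.1).2 j ht).trans (by gcongr)) (hja.trans (by gcongr))
    _ = 7 * C * δ := by ring
    _ ≤ ε := hδε.le

end Selection

section PathModifications

variable {A B Q : Type*} [NonUnitalCStarAlgebra A] [NonUnitalCStarAlgebra B]
  [NonUnitalCStarAlgebra Q] {ψ χ : Set.Ici (1 : ℝ) → A → B} {π : B →⋆ₙₐ[ℂ] Q} {φ : A → Q}

/-- The selfadjoint part `a ↦ (ψ_t(a) + ψ_t(a⋆)⋆) / 2` of the path `ψ`. -/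
noncomputable def starAverage (ψ : Set.Ici (1 : ℝ) → A → B) (t : Set.Ici (1 : ℝ)) (a : A) : B :=
  (2⁻¹ : ℂ) • (ψ t a + star (ψ t (star a)))

theorem starAverage_star (ψ : Set.Ici (1 : ℝ) → A → B) (t : Set.Ici (1 : ℝ)) (a : A) :
    starAverage ψ t (star a) = star (starAverage ψ t a) := by
  simp only [starAverage, star_smul, star_add, star_star, star_inv₀, star_ofNat, add_comm]

theorem continuous_starAverage (hψ : ∀ a, Continuous fun t => ψ t a) (a : A) :
    Continuous fun t => starAverage ψ t a :=
  ((hψ a).add (hψ (star a)).star).const_smul _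

theorem IsContractivePath.starAverage (hψ : IsContractivePath ψ) :
    IsContractivePath (starAverage ψ) := fun t a => by
  have hle := norm_add_le_of_le (hψ t a) ((norm_star _).trans_le (hψ t (star a)))
  rw [norm_star] at hle
  rw [_root_.starAverage, norm_smul, norm_inv, RCLike.norm_ofNat]
  linarith

theorem IsLiftPath.starAverage (hψ : IsLiftPath π φ ψ) (hφ : ∀ a, φ (star a) = star (φ a)) :
    IsLiftPath π φ (starAverage ψ) := fun t a => by
  rw [_root_.starAverage, map_smul, map_add, map_star, hψ, hψ, hφ, star_star, ← two_smul ℂ (φ a),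
    inv_smul_smul₀ two_ne_zero]

theorem IsLocallyAsymptotic.starAverage (h : IsLocallyAsymptotic ψ χ)
    (hχ : ∀ t a, χ t (star a) = star (χ t a)) : IsLocallyAsymptotic (starAverage ψ) χ :=
  fun a => by
  have hstar : Tendsto (fun p : Set.Ici (1 : ℝ) × A => (p.1, star p.2)) (atTop ×ˢ 𝓝 a)
      (atTop ×ˢ 𝓝 (star a)) := tendsto_id.prodMap (continuous_star.tendsto a)
  have hsum := (h a).add ((h (star a)).comp hstar).star |>.const_smul (2⁻¹ : ℂ)
  rw [star_zero, add_zero, smul_zero] at hsum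
  refine hsum.congr fun p => ?_
  rw [Function.comp_apply, hχ, star_sub, star_star, ← add_sub_add_comm, smul_sub,
    ← two_smul ℂ (χ p.1 a), inv_smul_smul₀ two_ne_zero, _root_.starAverage]

section Cutoff

/-- The path `ψ` with `ψ_t(a)` cut off at norm `‖a‖`. -/
noncomputable def cutoffPath (ψ : Set.Ici (1 : ℝ) → A → B) (t : Set.Ici (1 : ℝ)) (a : A) : B :=
  cutoff ‖a‖ (ψ t a)

theorem continuous_cutoffPath (hψ : ∀ a, Continuous fun t => ψ t a) (a : A) :
    Continuous fun t => cutoffPath ψ t a :=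
  (continuous_cutoff _).comp (hψ a)

theorem IsLiftPath.cutoffPath [PartialOrder Q] [StarOrderedRing Q] (hψ : IsLiftPath π φ ψ)
    (hφ : ∀ a, ‖φ a‖ ≤ ‖a‖) : IsLiftPath π φ (cutoffPath ψ) := fun t a => by
  rw [_root_.cutoffPath, map_cutoff, hψ, cutoff_of_norm_le (hφ a)]

variable [PartialOrder B] [StarOrderedRing B]

theorem isContractivePath_cutoffPath (ψ : Set.Ici (1 : ℝ) → A → B) :
    IsContractivePath (cutoffPath ψ) := fun _ _ => norm_cutoff_le (norm_nonneg _) _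

theorem IsLocallyAsymptotic.cutoffPath (h : IsLocallyAsymptotic ψ χ) (hψ : IsLiftPath π φ ψ)
    (hφ : ∀ a, ‖φ a‖ ≤ ‖a‖)
    (hπ : ∀ a, AttainsQuotientNorm π (atTop ×ˢ 𝓝 a) fun p => ψ p.1 p.2) :
    IsLocallyAsymptotic (cutoffPath ψ) χ := by
  refine h.of_tendsto_sub fun a => squeeze_zero_norm (fun p => ?_) (hπ a)
  refine (norm_cutoff_sub_le (norm_nonneg _) _).trans (max_le ?_ ?_)
  · exact sub_nonneg.mpr (NonUnitalStarAlgHom.norm_apply_le π _)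
  · rw [hψ]
    exact sub_le_sub_left (hφ _) _

end Cutoff

variable [PartialOrder A]

open Classical in
/-- The path `ψ` with `ψ_t(a)` replaced by its positive part whenever `a` is positive. -/
noncomputable def posPartPath (ψ : Set.Ici (1 : ℝ) → A → B) (t : Set.Ici (1 : ℝ)) (a : A) : B :=
  if 0 ≤ a then (ψ t a)⁺ else ψ t a

theorem isPositivePath_posPartPath [PartialOrder B] [StarOrderedRing B]
    (ψ : Set.Ici (1 : ℝ) → A → B) : IsPositivePath (posPartPath ψ) := fun t a ha => by
  rw [posPartPath, if_pos ha]
  exact CFC.posPart_nonneg _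

theorem IsContractivePath.posPartPath (hψ : IsContractivePath ψ) :
    IsContractivePath (posPartPath ψ) := fun t a => by
  unfold _root_.posPartPath
  split_ifs
  · exact (CStarAlgebra.norm_posPart_le _).trans (hψ t a)
  · exact hψ t a

variable [StarOrderedRing A]

theorem continuous_posPartPath (hψ : ∀ t a, ψ t (star a) = star (ψ t a))
    (hψc : ∀ a, Continuous fun t => ψ t a) (a : A) :
    Continuous fun t => posPartPath ψ t a := by
  unfold posPartPath
  split_ifs with ha
  · simp only [CFC.posPart_def]
    exact continuous_cfcₙ_of_isSelfAdjoint continuous_posPart posPart_zero (hψc a)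
      fun t => isSelfAdjoint_of_map_star (hψ t) ha.isSelfAdjoint
  · exact hψc a

theorem IsLiftPath.posPartPath [PartialOrder Q] [StarOrderedRing Q] (hl : IsLiftPath π φ ψ)
    (hψ : ∀ t a, ψ t (star a) = star (ψ t a)) (hφ : ∀ a, 0 ≤ a → 0 ≤ φ a) :
    IsLiftPath π φ (posPartPath ψ) := fun t a => by
  unfold _root_.posPartPath
  split_ifs with ha
  · rw [map_posPart π (isSelfAdjoint_of_map_star (hψ t) ha.isSelfAdjoint), hl,
      (CFC.posPart_eq_self _).mpr (hφ a ha)]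
  · exact hl t a

variable [PartialOrder B] [StarOrderedRing B]

theorem posPartPath_star (hψ : ∀ t a, ψ t (star a) = star (ψ t a)) (t : Set.Ici (1 : ℝ)) (a : A) :
    posPartPath ψ t (star a) = star (posPartPath ψ t a) := by
  by_cases ha : 0 ≤ a
  · rw [ha.star_eq, posPartPath, if_pos ha, (CFC.posPart_nonneg _).star_eq]
  · rw [posPartPath, posPartPath, if_neg ha, if_neg (mt star_nonneg_iff.mp ha), hψ]

theorem IsLocallyAsymptotic.posPartPath (h : IsLocallyAsymptotic ψ χ)
    (hψ : ∀ t a, ψ t (star a) = star (ψ t a)) (hχ : IsAsymptoticallyCP χ) :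
    IsLocallyAsymptotic (posPartPath ψ) χ := by
  refine h.of_tendsto_sub fun a => ?_
  by_cases ha : 0 ≤ a
  · have hsmall := ((hχ.tendsto_norm_negPart ha).comp tendsto_fst).add (h a).norm
    rw [norm_zero, add_zero] at hsmall
    refine squeeze_zero_norm (fun p => ?_) hsmall
    unfold _root_.posPartPath
    split_ifs with hp
    · have hsa := isSelfAdjoint_of_map_star (hψ p.1) hp.isSelfAdjoint
      nth_rw 2 [← CFC.posPart_sub_negPart (ψ p.1 p.2) hsa]
      rw [sub_sub_cancel]
      exact norm_negPart_le_add hsa (hχ.isSelfAdjoint p.1 ha.isSelfAdjoint)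
    · rw [sub_self, norm_zero]
      exact add_nonneg (norm_nonneg _) (norm_nonneg _)
  · have hne : ∀ᶠ b in 𝓝 a, ¬0 ≤ b := CStarAlgebra.isClosed_nonneg.isOpen_compl.mem_nhds ha
    have hzero : ∀ᶠ p in atTop ×ˢ 𝓝 a, _root_.posPartPath ψ p.1 p.2 - ψ p.1 p.2 = 0 :=
      (hne.prod_inr atTop).mono fun p hp => by
        rw [_root_.posPartPath, if_neg hp, sub_self]
    exact tendsto_nhds_of_eventually_eq hzero

end PathModifications

section UniformLimits

variable {ι κ : Type*} {l : Filter ι} {f : ι → κ → ℝ} {F : κ → ℝ}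

theorem tendsto_iSup_of_tendstoUniformly (h : TendstoUniformly f F l)
    (hF : BddAbove (Set.range F)) : Tendsto (fun i => ⨆ k, f i k) l (𝓝 (⨆ k, F k)) := by
  rcases isEmpty_or_nonempty κ with _ | _
  · simpa only [Real.iSup_of_isEmpty] using tendsto_const_nhds
  refine Metric.nhds_basis_closedBall.tendsto_right_iff.mpr fun ε hε => ?_
  filter_upwards [Metric.tendstoUniformly_iff.mp h ε hε] with i hi
  have hclose (k : κ) : |F k - f i k| ≤ ε := (hi k).le
  have hle (k : κ) : f i k ≤ (⨆ k, F k) + ε := by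
    linarith [neg_le_of_abs_le (hclose k), le_ciSup hF k]
  refine abs_sub_le_iff.mpr ⟨sub_le_iff_le_add'.mpr (ciSup_le hle), ?_⟩
  have hbdd : BddAbove (Set.range (f i)) := ⟨_, Set.forall_mem_range.mpr hle⟩
  refine sub_le_iff_le_add'.mpr (ciSup_le fun k => ?_)
  linarith [le_of_abs_le (hclose k), le_ciSup hbdd k]

end UniformLimits

section Equivariance

variable {G A B Q : Type*} [Group G] [NonUnitalCStarAlgebra A]
  [NonUnitalCStarAlgebra B] [NonUnitalCStarAlgebra Q] {α : G →* (A ≃⋆ₐ[ℂ] A)}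
  {β : G →* (B ≃⋆ₐ[ℂ] B)} {γ : G →* (Q ≃⋆ₐ[ℂ] Q)} {π : B →⋆ₙₐ[ℂ] Q} {φ : A → Q}
  {ψ : Set.Ici (1 : ℝ) → A → B} {a : A} {K : Set G}

theorem tendsto_iSup_norm_apply_sub (hφ : ∀ a, ‖φ a‖ ≤ ‖a‖)
    (h : TendstoUniformlyOn (fun t (p : G × G) => ‖β p.1 (ψ t a) - ψ t (α p.2 a)‖)
      (fun p : G × G => ‖γ p.1 (φ a) - φ (α p.2 a)‖) atTop (K ×ˢ K)) :
    Tendsto (fun t => ⨆ p : ↥(K ×ˢ K), ‖β p.1.1 (ψ t a) - ψ t (α p.1.2 a)‖) atTop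
      (𝓝 (⨆ p : ↥(K ×ˢ K), ‖γ p.1.1 (φ a) - φ (α p.1.2 a)‖)) := by
  refine tendsto_iSup_of_tendstoUniformly
    (tendstoUniformlyOn_iff_tendstoUniformly_comp_coe.mp h) ⟨‖a‖ + ‖a‖, ?_⟩
  rintro _ ⟨p, rfl⟩
  exact norm_sub_le_of_le ((StarAlgEquiv.norm_map (γ p.1.1) _).trans_le (hφ a))
    ((hφ _).trans_eq (StarAlgEquiv.norm_map (α p.1.2) a))

variable [TopologicalSpace G]

theorem tendstoUniformlyOn_norm_apply_sub (hα : IsContinuousAction α)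
    (hγ : ∀ g b, π (β g b) = γ g (π b)) (hψ : IsLiftPath π φ ψ)
    (h : ∀ b g, AttainsQuotientNorm π (atTop ×ˢ 𝓝 (g, b))
      fun p : Set.Ici (1 : ℝ) × G × A => β p.2.1 (ψ p.1 a) - ψ p.1 p.2.2) (hK : IsCompact K) :
    TendstoUniformlyOn (fun t (p : G × G) => ‖β p.1 (ψ t a) - ψ t (α p.2 a)‖)
      (fun p : G × G => ‖γ p.1 (φ a) - φ (α p.2 a)‖) atTop (K ×ˢ K) := by
  rw [← tendstoLocallyUniformlyOn_iff_tendstoUniformlyOn_of_compact (hK.prod hK),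
    tendstoLocallyUniformlyOn_iff_forall_tendsto]
  rintro ⟨g, g'⟩ -
  have horbit : Tendsto (fun p : G × G => (p.1, α p.2 a)) (𝓝[K ×ˢ K] (g, g'))
      (𝓝 (g, α g' a)) :=
    ((continuous_fst.prodMk ((hα a).comp continuous_snd)).tendsto (g, g')).mono_left
      nhdsWithin_le_nhds
  have hnorm := ((h (α g' a) g).comp (tendsto_id.prodMap horbit)).norm
  rw [norm_zero] at hnorm
  refine tendsto_uniformity_iff_dist_tendsto_zero.mpr (hnorm.congr fun p => ?_)
  simp only [Function.comp_apply, Prod.map_fst, Prod.map_snd, id_eq, map_sub, hγ, hψ p.1 _,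
    dist_comm ‖γ p.2.1 (φ a) - φ (α p.2.2 a)‖, Real.dist_eq, Real.norm_eq_abs]

theorem isAsymptoticallyEquivariant_of_tendstoUniformlyOn
    (h : ∀ (a : A) (K : Set G), IsCompact K →
      TendstoUniformlyOn (fun t (p : G × G) => ‖β p.1 (ψ t a) - ψ t (α p.2 a)‖)
        (fun p : G × G => ‖γ p.1 (φ a) - φ (α p.2 a)‖) atTop (K ×ˢ K))
    (hφ : ∀ g a, φ (α g a) = γ g (φ a)) : IsAsymptoticallyEquivariant α β ψ := fun a K hK => by
  simpa only [Function.comp_def, hφ, sub_self, norm_zero] using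
    ((h a K hK).comp fun g => (g, g)).mono fun g hg => ⟨hg, hg⟩

end Equivariance

section ContractivePositiveLift

variable {A B Q : Type*} [NonUnitalCStarAlgebra A] [PartialOrder A] [StarOrderedRing A]
  [NonUnitalCStarAlgebra B] [PartialOrder B] [StarOrderedRing B]
  {ψ χ : Set.Ici (1 : ℝ) → A → B}

theorem IsAsymptoticallyCP.of_tendsto_sub (hχ : IsAsymptoticallyCP χ)
    (hψc : ∀ a, Continuous fun t => ψ t a) (hψb : ∀ a, ∃ C, ∀ t, ‖ψ t a‖ ≤ C)
    (hψs : ∀ t a, ψ t (star a) = star (ψ t a))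
    (h : ∀ a, Tendsto (fun t => ψ t a - χ t a) atTop (𝓝 0)) : IsAsymptoticallyCP ψ where
  continuous_path := hψc
  bounded := hψb
  map_star := hψs
  asymptotically_linear μ ν a b := by
    have hdefect := ((h (μ • a + ν • b)).sub ((h a).const_smul μ)).sub ((h b).const_smul ν)
    have hlin := tendsto_zero_iff_norm_tendsto_zero.mpr (hχ.asymptotically_linear μ ν a b)
    refine tendsto_zero_iff_norm_tendsto_zero.mp ?_
    convert hdefect.add hlin using 2
    · module
    · simp only [smul_zero, sub_zero, add_zero]
  asymptotically_positive n M hM := by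
    have hsum := (hχ.asymptotically_positive n M hM).add (tendsto_cstarMatrix_map_sub M h).norm
    rw [norm_zero, add_zero] at hsum
    exact squeeze_zero (fun _ => norm_nonneg _) (fun t => norm_negPart_le_add
      (isSelfAdjoint_cstarMatrix_map (hψs t) hM.isSelfAdjoint)
      (isSelfAdjoint_cstarMatrix_map (hχ.map_star t) hM.isSelfAdjoint)) hsum

variable [NonUnitalCStarAlgebra Q] [PartialOrder Q] [StarOrderedRing Q] {π : B →⋆ₙₐ[ℂ] Q}

theorem exists_contractive_positive_lift [TopologicalSpace.SeparableSpace A] {φ : A →CP Q}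
    (hφ : ∀ a, ‖φ a‖ ≤ ‖a‖) (hχ : IsAsymptoticallyCP χ) (hlift : IsLiftPath π φ χ) {D : Set A}
    (hD : Dense D) (hD' : ∀ a ∈ D, AttainsQuotientNorm π atTop fun t => χ t a) :
    ∃ ψ, IsAsymptoticallyCP ψ ∧ IsLiftPath π φ ψ ∧ IsContractivePath ψ ∧ IsPositivePath ψ ∧
      IsLocallyAsymptotic ψ χ := by
  obtain ⟨C, hC, hχC⟩ := hχ.exists_eventually_norm_sub_le
  obtain ⟨ψ, hψc, hψl, hψχ⟩ := exists_isLocallyAsymptotic hχ.continuous_path hlift hC hχC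
  have hφs (a : A) : φ (star a) = star (φ a) := by
    rw [← hlift ⟨1, Set.self_mem_Ici⟩, ← hlift ⟨1, Set.self_mem_Ici⟩, hχ.map_star, map_star]
  have hloc := (hψχ.cutoffPath hψl hφ (hψχ.attainsQuotientNorm hC hχC hD hD')).starAverage
    hχ.map_star
  have hstar := starAverage_star (cutoffPath ψ)
  have hcont := continuous_starAverage (continuous_cutoffPath hψc)
  have hcontr := (isContractivePath_cutoffPath ψ).starAverage.posPartPath
  have hloc' := hloc.posPartPath hstar hχ
  exact ⟨posPartPath (starAverage (cutoffPath ψ)),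
    hχ.of_tendsto_sub (continuous_posPartPath hstar hcont) (fun a => ⟨‖a‖, fun t => hcontr t a⟩)
      (posPartPath_star hstar) hloc'.tendsto,
    ((hψl.cutoffPath hφ).starAverage hφs).posPartPath hstar fun _ => map_nonneg φ,
    hcontr, isPositivePath_posPartPath _, hloc'⟩

end ContractivePositiveLift

theorem proposition4p10_general
    {G : Type*} [Group G] [TopologicalSpace G] [WeaklyLocallyCompactSpace G] [SigmaCompactSpace G]
    {A B Q : Type*}
    [NonUnitalCStarAlgebra A] [PartialOrder A] [StarOrderedRing A]
    [TopologicalSpace.SeparableSpace A]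
    [NonUnitalCStarAlgebra B] [PartialOrder B] [StarOrderedRing B]
    [NonUnitalCStarAlgebra Q] [PartialOrder Q] [StarOrderedRing Q]
    (α : G →* (A ≃⋆ₐ[ℂ] A)) (hα : IsContinuousAction α)
    (β : G →* (B ≃⋆ₐ[ℂ] B)) (hβ : IsContinuousAction β)
    (π : B →⋆ₙₐ[ℂ] Q) (γ : G →* (Q ≃⋆ₐ[ℂ] Q)) (hγ : ∀ g b, π (β g b) = γ g (π b))
    (φ : A →CP Q) (hφ : ∀ a, ‖φ a‖ ≤ ‖a‖)
    (ψ : Set.Ici (1 : ℝ) → A → B) (hψ : IsAsymptoticallyCP ψ) (hψφ : IsLiftPath π φ ψ) :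
    ∃ ψ' : Set.Ici (1 : ℝ) → A → B,
      IsAsymptoticallyCP ψ' ∧ IsLiftPath π φ ψ' ∧ IsContractivePath ψ' ∧ IsPositivePath ψ' ∧
      (∀ a b : A, Tendsto (fun t => ‖ψ' t a * ψ' t b‖) atTop (𝓝 ‖φ a * φ b‖)) ∧
      (∀ (a : A) (K : Set G), IsCompact K →
        TendstoUniformlyOn
          (fun t (p : G × G) => ‖β p.1 (ψ' t a) - ψ' t (α p.2 a)‖)
          (fun p : G × G => ‖γ p.1 (φ a) - φ (α p.2 a)‖) atTop (K ×ˢ K)) ∧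
      (∀ (a : A) (K : Set G), IsCompact K →
        Tendsto
          (fun t => ⨆ p : ↥(K ×ˢ K), ‖β p.1.1 (ψ' t a) - ψ' t (α p.1.2 a)‖) atTop
          (𝓝 (⨆ p : ↥(K ×ˢ K), ‖γ p.1.1 (φ a) - φ (α p.1.2 a)‖))) ∧
      ((∀ g a, φ (α g a) = γ g (φ a)) → IsAsymptoticallyEquivariant α β ψ') ∧
      (IsOrderZero φ → IsAsymptoticallyOrderZero ψ') := by
  obtain ⟨D, hDc, hD⟩ := TopologicalSpace.exists_countable_dense A
  obtain ⟨u, hu⟩ := exists_isQuasicentralPath hβ π (fun g b hb => by rw [hγ, hb, map_zero])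
    (continuous_of_mem_testPaths hβ hψ.continuous_path D) (countable_testPaths β ψ hDc)
  have hχ : IsAsymptoticallyCP (compressPath u ψ) := hψ.compressPath hu.continuous
    (fun t => (hu.mem_idealContractions t).1) fun t => (hu.mem_idealContractions t).2.1
  obtain ⟨C, hC, hχC⟩ := hχ.exists_eventually_norm_sub_le
  obtain ⟨ψ', hψ', hlift, hcontr, hpos, hloc⟩ := exists_contractive_positive_lift hφ hχ
    (hψφ.compressPath fun t => (hu.mem_idealContractions t).2.2) hD
    fun a ha => hu.attainsQuotientNorm_compressPath ha
  have hmul (a b : A) : Tendsto (fun t => ‖ψ' t a * ψ' t b‖) atTop (𝓝 ‖φ a * φ b‖) :=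
    (hloc.attainsQuotientNorm_mul hC hχC hD hcontr (fun a ha b hb =>
      hu.attainsQuotientNorm_mul ha hb (hψ.bounded a).choose_spec) a b).tendsto_norm
      fun t => by rw [map_mul, hlift, hlift]
  have hunif (a : A) (K : Set G) (hK : IsCompact K) :=
    tendstoUniformlyOn_norm_apply_sub hα hγ hlift (hloc.attainsQuotientNorm_apply_sub hC hχC hD
      (fun a ha b hb => hu.attainsQuotientNorm_apply_sub ha hb (hψ.bounded a).choose_spec) a) hK
  refine ⟨ψ', hψ', hlift, hcontr, hpos, hmul, hunif,
    fun a K hK => tendsto_iSup_norm_apply_sub hφ (hunif a K hK),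
    isAsymptoticallyEquivariant_of_tendstoUniformlyOn hunif, fun hzero a b ha hb hab => ?_⟩
  simpa only [hzero a b ha hb hab, norm_zero] using hmul a b

theorem proposition4p10
    {G : Type*} [Group G] [TopologicalSpace G] [IsTopologicalGroup G] [LocallyCompactSpace G]
    [SecondCountableTopology G]
    {A B Q : Type*}
    [NonUnitalCStarAlgebra A] [PartialOrder A] [StarOrderedRing A]
    [TopologicalSpace.SeparableSpace A]
    [NonUnitalCStarAlgebra B] [PartialOrder B] [StarOrderedRing B]
    [NonUnitalCStarAlgebra Q] [PartialOrder Q] [StarOrderedRing Q]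
    (α : G →* (A ≃⋆ₐ[ℂ] A)) (hα : IsContinuousAction α)
    (β : G →* (B ≃⋆ₐ[ℂ] B)) (hβ : IsContinuousAction β)
    -- `Q = B / I` with `I = ker π` a `G`-invariant ideal; `γ` is the induced action on `B / I`
    (π : B →⋆ₙₐ[ℂ] Q) (hπ : Function.Surjective π)
    (γ : G →* (Q ≃⋆ₐ[ℂ] Q)) (hγ : ∀ g b, π (β g b) = γ g (π b))
    (φ : A →CP Q) (hφ : ∀ a, ‖φ a‖ ≤ ‖a‖)
    (ψ : Set.Ici (1 : ℝ) → A → B) (hψ : IsAsymptoticallyCP ψ) (hψφ : IsLiftPath π φ ψ) :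
    ∃ ψ' : Set.Ici (1 : ℝ) → A → B,
      IsAsymptoticallyCP ψ' ∧ IsLiftPath π φ ψ' ∧
      (IsContractivePath ψ → IsContractivePath ψ') ∧
      (IsPositivePath ψ → IsPositivePath ψ') ∧
      (∀ a b : A, Tendsto (fun t => ‖ψ' t a * ψ' t b‖) atTop (𝓝 ‖φ a * φ b‖)) ∧
      (∀ (a : A) (K : Set G), IsCompact K →
        TendstoUniformlyOn
          (fun t (p : G × G) => ‖β p.1 (ψ' t a) - ψ' t (α p.2 a)‖)
          (fun p : G × G => ‖γ p.1 (φ a) - φ (α p.2 a)‖) atTop (K ×ˢ K)) ∧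
      (∀ (a : A) (K : Set G), IsCompact K →
        Tendsto
          (fun t => ⨆ p : ↥(K ×ˢ K), ‖β p.1.1 (ψ' t a) - ψ' t (α p.1.2 a)‖) atTop
          (𝓝 (⨆ p : ↥(K ×ˢ K), ‖γ p.1.1 (φ a) - φ (α p.1.2 a)‖))) ∧
      ((∀ g a, φ (α g a) = γ g (φ a)) → IsAsymptoticallyEquivariant α β ψ') ∧
      (IsOrderZero φ → IsAsymptoticallyOrderZero ψ') := by
  obtain ⟨ψ', hψ', hlift, hcontr, hpos, h⟩ :=
    proposition4p10_general α hα β hβ π γ hγ φ hφ ψ hψ hψφ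
  exact ⟨ψ', hψ', hlift, fun _ => hcontr, fun _ => hpos, h⟩
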